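/- Let $N\ge 1$, fix a qubit $\ell$ among $N$ qubits, and let $Z^{(\ell)}$ denote the Pauli operator $Z=\mathrm{diag}(1,-1)$ applied to $\ell$. A $CZ^{(\ell)}$-circuit is a finite product of unitary gates on the $N$ qubits, each of which is either a one-qubit gate on $\ell$, or a controlled-$Z$ gate $CZ^{(\ell,m)}$ with $m\neq\ell$, or an arbitrary gate acting only on qubits other than $\ell$. For an $N$-qubit unitary operator $M$, the local $CZ$-cost $|M|_{CZ;\ell}$ is the minimum number of $CZ$ gates incident on $\ell$ in a $CZ^{(\ell)}$-circuit that computes $M$. Suppose that $M$ commutes with $Z^{(\ell)}$ and that $|M|_{CZ;\ell}=3$. Let $\mathcal C$ be a $CZ^{(\ell)}$-circuit that computes $M$ with exactly three $CZ$ gates incident on $\ell$. Merge the one-qubit gates of $\mathcal C$ on $\ell$: the three $CZ$ gates incident on $\ell$ cut $\mathcal C$ into four segments, and in each segment the one-qubit gates on $\ell$ are replaced by their product, in order (the identity if there are none). Then each of the four resulting one-qubit gates on $\ell$ is diagonal or anti-diagonal, where a one-qubit gate $u$ is called anti-diagonal if $uX$ is diagonal, $X$ being the Pauli operator $\begin{pmatrix}0&1\\1&0\end{pmatrix}$.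 -/

import Mathlib

noncomputable section

namespace LocalCZ

/-- Computational basis of the qubits labelled by `ι`. -/
abbrev Basis (ι : Type) := ι → Fin 2

def pauliX : Matrix (Fin 2) (Fin 2) ℂ := !![0, 1; 1, 0]

def pauliZ : Matrix (Fin 2) (Fin 2) ℂ := !![1, 0; 0, -1]

/-- A one-qubit operator is anti-diagonal if it becomes diagonal when multiplied by `X`. -/
def IsAntiDiag (u : Matrix (Fin 2) (Fin 2) ℂ) : Prop := (u * pauliX).IsDiag

/-- The `N`-qubit operator which applies the one-qubit operator `u` on qubit `q`. -/
def onQubit {N : ℕ} (q : Fin N) (u : Matrix (Fin 2) (Fin 2) ℂ) :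
    Matrix (Basis (Fin N)) (Basis (Fin N)) ℂ :=
  Matrix.of fun x y => if ∀ k, k ≠ q → x k = y k then u (x q) (y q) else 0

/-- The controlled-`Z` gate on the qubits `i` and `j`. -/
def czOp {N : ℕ} (i j : Fin N) : Matrix (Basis (Fin N)) (Basis (Fin N)) ℂ :=
  Matrix.diagonal fun x => if x i = 1 ∧ x j = 1 then -1 else 1

/-- The `N`-qubit operator which applies `V` on the qubits other than `q`
and does not touch `q`. -/
def awayFrom {N : ℕ} (q : Fin N) (V : Matrix (Basis {k // k ≠ q}) (Basis {k // k ≠ q}) ℂ) :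
    Matrix (Basis (Fin N)) (Basis (Fin N)) ℂ :=
  Matrix.of fun x y => if x q = y q then V (fun k => x k) (fun k => y k) else 0

/-- The gates allowed in a circuit in which every multi-qubit gate touching `q` is a `CZ`. -/
inductive Gate {N : ℕ} (q : Fin N) : Type
  /-- a one-qubit gate on `q` -/
  | oneQubit (u : Matrix.unitaryGroup (Fin 2) ℂ)
  /-- a `CZ` gate joining `q` to another qubit -/
  | cz (m : {k : Fin N // k ≠ q})
  /-- an arbitrary gate on (some of) the qubits other than `q` -/
  | away (V : Matrix.unitaryGroup (Basis {k // k ≠ q}) ℂ)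

/-- The `N`-qubit operator of a gate. -/
def Gate.op {N : ℕ} {q : Fin N} : Gate q → Matrix (Basis (Fin N)) (Basis (Fin N)) ℂ
  | .oneQubit u => onQubit q u
  | .cz m => czOp q m
  | .away V => awayFrom q V

/-- Circuits in which every multi-qubit gate touching `q` is a `CZ`, written in the order of
the operator product: the last gate of the list is applied first. -/
abbrev Circuit {N : ℕ} (q : Fin N) := List (Gate q)

/-- The operator computed by a circuit. -/
def Circuit.op {N : ℕ} {q : Fin N} (C : Circuit q) :
    Matrix (Basis (Fin N)) (Basis (Fin N)) ℂ :=
  (C.map Gate.op).prod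

/-- The number of `CZ` gates incident on `q`. -/
def Circuit.czCount {N : ℕ} {q : Fin N} : Circuit q → ℕ
  | [] => 0
  | .oneQubit _ :: C => Circuit.czCount C
  | .cz _ :: C => Circuit.czCount C + 1
  | .away _ :: C => Circuit.czCount C

/-- The local `CZ`-cost of `M` at `q`: the minimum number of `CZ` gates incident on `q` in a
circuit for `M` in which every multi-qubit gate touching `q` is a `CZ`. It is `⊤` if there is
no such circuit. -/
def czCost {N : ℕ} (q : Fin N) (M : Matrix (Basis (Fin N)) (Basis (Fin N)) ℂ) : ℕ∞ :=
  ⨅ C : {C : Circuit q // C.op = M}, (C.1.czCount : ℕ∞)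

/-- The one-qubit gates on `q`, after all one-qubit gates on `q` that are not separated by a
`CZ` incident on `q` have been multiplied together. A circuit with `n` such `CZ` gates gives a
list of `n + 1` gates, where a segment without one-qubit gates on `q` contributes the identity. -/
def Circuit.mergedGates {N : ℕ} {q : Fin N} : Circuit q → List (Matrix.unitaryGroup (Fin 2) ℂ)
  | [] => [1]
  | .oneQubit u :: C => (Circuit.mergedGates C).modifyHead (u * ·)
  | .cz _ :: C => 1 :: Circuit.mergedGates C
  | .away _ :: C => Circuit.mergedGates C

end LocalCZ

end

open scoped Matrix ComplexOrder

namespace LocalCZ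

/-! View an operator as a 2×2 block matrix indexed by the qubit `l`. A `CZ` becomes `blk 1 Z`. Gates
on the other qubits commute with one-qubit gates on `l` and can be pushed to the right end,
conjugating each `Z` into a Hermitian involution of trace zero, a reflection. So `M = triple W₁ W₂
W₃ u₀ u₁ u₂ u₃ * blk V V`. Since `M` commutes with `Z` on `l`, the triple equals some `blk A B`.

The dichotomy `diagOrAnti_or_factors` says that either all four `uᵢ` are diagonal or anti-diagonal,
or `B = A * F * G` with `F`, `G` unitary, traceless and of scalar square. Such an `F` is a phase
times a conjugate of `Z` (`IsBal.exists_smul`), so `blk 1 F` costs one `CZ`. In the second case `blk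
A A * blk 1 F * blk 1 G` computes the triple with two `CZ` gates, contradicting cost three.

For the dichotomy, commutation with `Z` is rewritten as `triple_equation`, an identity between
conjugates of `Z` by the two outer parts of the circuit. Its blocks (`triple_entries`) tie the `Wᵢ`
to the Bloch coordinates of the `uᵢ`. In most exceptional cases the reflections lie in an algebra
spanned by `1, W, W', W * W'` with `W * W' + W' * W` scalar; there `Aᴴ * B` is a scalar plus a
traceless part of scalar square, and factors as required. The remaining cases rest on
`IsRefl.exists_anticomm`: any two reflections anticommute with a common reflection `Q`. Moving `Q`
through the circuit compares `A` with `B`, or makes short products balanced. -/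

theorem exists_perm_comp_eq {n α : Type*} [Fintype n] [DecidableEq α] (f g : n → α)
    (h : ∀ a, (Finset.univ.filter fun i => f i = a).card
      = (Finset.univ.filter fun i => g i = a).card) :
    ∃ e : Equiv.Perm n, ∀ i, g (e i) = f i := by
  have key : ∀ a, Nonempty ({i // f i = a} ≃ {i // g i = a}) := fun a => by
    rw [← Fintype.card_eq, Fintype.card_subtype, Fintype.card_subtype, h a]
  have k := fun a => (key a).some
  refine ⟨(Equiv.sigmaFiberEquiv f).symm.trans
    ((Equiv.sigmaCongrRight k).trans (Equiv.sigmaFiberEquiv g)), fun i => ?_⟩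
  simpa [Equiv.sigmaFiberEquiv] using (k (f i) ⟨i, rfl⟩).2

/-! ### Spectral theory: signs of Hermitian matrices and symmetries of a spectrum. -/

section Spectral

variable {n : Type*} [Fintype n] [DecidableEq n]

theorem exists_unitary_diagonalization {T : Matrix n n ℂ} (hT : Tᴴ = T) :
    ∃ (V : Matrix n n ℂ) (e : n → ℝ), Vᴴ * V = 1 ∧ V * Vᴴ = 1 ∧
      T = V * Matrix.diagonal (fun i => (e i : ℂ)) * Vᴴ := by
  have h : T.IsHermitian := hT
  refine ⟨h.eigenvectorUnitary, h.eigenvalues, ?_, ?_, ?_⟩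
  · exact Unitary.coe_star_mul_self h.eigenvectorUnitary
  · exact Unitary.coe_mul_star_self h.eigenvectorUnitary
  · conv_lhs => rw [h.spectral_theorem, Unitary.conjStarAlgAut_apply]
    rfl

theorem conj_mul_conj {V : Matrix n n ℂ} (h : Vᴴ * V = 1) (X Y : Matrix n n ℂ) :
    (V * X * Vᴴ) * (V * Y * Vᴴ) = V * (X * Y) * Vᴴ := by
  calc _ = V * X * (Vᴴ * V) * Y * Vᴴ := by simp only [mul_assoc]
    _ = _ := by rw [h]; simp only [mul_assoc, mul_one]

theorem trace_conj {V : Matrix n n ℂ} (h : Vᴴ * V = 1) (X : Matrix n n ℂ) :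
    Matrix.trace (V * X * Vᴴ) = X.trace := by
  rw [Matrix.trace_mul_comm, ← mul_assoc, h, one_mul]

theorem eq_conj_conj {V : Matrix n n ℂ} (h : V * Vᴴ = 1) (X : Matrix n n ℂ) :
    X = V * (Vᴴ * X * V) * Vᴴ := by
  calc X = (V * Vᴴ) * X * (V * Vᴴ) := by rw [h]; simp
    _ = _ := by simp only [mul_assoc]

theorem conj_injective {V : Matrix n n ℂ} (h : Vᴴ * V = 1) {X Y : Matrix n n ℂ}
    (e : V * X * Vᴴ = V * Y * Vᴴ) : X = Y := by
  have := congrArg (fun Z => Vᴴ * Z * V) e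
  simpa only [mul_assoc, h, mul_one, ← mul_assoc Vᴴ V, one_mul] using this

/-- The sign of a Hermitian matrix, with its defining relations. -/
theorem exists_sign {T : Matrix n n ℂ} (hT : Tᴴ = T) :
    ∃ S : Matrix n n ℂ, Sᴴ = S ∧ S * S * S = S ∧ (1 - S * S) * T = 0 ∧
      ∀ X, X * T = -(T * X) → X * S = -(S * X) := by
  obtain ⟨V, e, h1, h2, rfl⟩ := exists_unitary_diagonalization hT
  have hs : ∀ x : ℝ, ((SignType.sign x : ℝ) : ℂ) * (SignType.sign x : ℝ) * (SignType.sign x : ℝ)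
      = (SignType.sign x : ℝ) := fun x => by
    rcases lt_trichotomy x 0 with h | h | h <;> simp [h]
  have hs' : ∀ x : ℝ, (1 - ((SignType.sign x : ℝ) : ℂ) * (SignType.sign x : ℝ)) * x = 0 := fun x => by
    rcases lt_trichotomy x 0 with h | h | h <;> simp [h]
  -- The sign function is applied to the eigenvalues. It is odd, and a matrix anticommuting with `T`
  -- has nonzero entries only between eigenvalues `e` and `-e`, so anticommutation passes to the
  -- sign.
  refine ⟨V * Matrix.diagonal (fun i => (((SignType.sign (e i) : ℝ)) : ℂ)) * Vᴴ, ?_, ?_, ?_, ?_⟩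
  · rw [Matrix.conjTranspose_mul, Matrix.conjTranspose_mul, Matrix.conjTranspose_conjTranspose,
      Matrix.diagonal_conjTranspose, ← mul_assoc]
    congr 3
    ext i
    simp
  · rw [conj_mul_conj h1, conj_mul_conj h1, Matrix.diagonal_mul_diagonal, Matrix.diagonal_mul_diagonal]
    simp only [hs]
  · have : (1 : Matrix n n ℂ) = V * 1 * Vᴴ := by simp [h2]
    rw [conj_mul_conj h1, this, ← sub_mul, ← mul_sub, conj_mul_conj h1, Matrix.diagonal_mul_diagonal,
      ← Matrix.diagonal_one, Matrix.diagonal_sub, Matrix.diagonal_mul_diagonal]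
    simp only [hs']
    simp
  · intro X hX
    rw [eq_conj_conj h2 X] at hX ⊢
    rw [conj_mul_conj h1, conj_mul_conj h1, ← neg_mul, ← mul_neg] at hX ⊢
    have h3 := conj_injective h1 hX
    congr 2
    ext i j
    have h4 := congrFun (congrFun h3 i) j
    rw [Matrix.neg_apply] at h4 ⊢
    rw [Matrix.mul_diagonal, Matrix.diagonal_mul] at h4 ⊢
    generalize (Vᴴ * X * V) i j = x at h4 ⊢
    by_cases hx : x = 0
    · simp [hx]
    · have : (e j : ℂ) = ((-e i : ℝ) : ℂ) := by
        push_cast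
        exact mul_left_cancel₀ hx (by rw [h4]; ring)
      rw [Complex.ofReal_inj.1 this, Left.sign_neg]
      simp [mul_comm]

/-- With `a` and `b` the excess multiplicities of `1` over `-1` and of `3` over `-3`, the two power
sums read `a + 3 * b = 0` and `a + 27 * b = 0`, so both vanish and the spectrum is symmetric. -/
theorem exists_swap_perm (e : n → ℝ) (he : ∀ i, e i = 0 ∨ e i = 1 ∨ e i = -1 ∨ e i = 3 ∨ e i = -3)
    (h1 : ∑ i, e i = 0) (h3 : ∑ i, e i ^ 3 = 0) :
    ∃ p : n → n, (∀ i, p (p i) = i) ∧ ∀ i, e (p i) = - e i := by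
  have e1 : ∀ i, e i = (if e i = 1 then 1 else 0) - (if e i = -1 then 1 else 0)
      + 3 * (if e i = 3 then 1 else 0) - 3 * (if e i = -3 then 1 else 0) := fun i => by
    rcases he i with h | h | h | h | h <;> rw [h] <;> norm_num
  have e3 : ∀ i, e i ^ 3 = (if e i = 1 then 1 else 0) - (if e i = -1 then 1 else 0)
      + 27 * (if e i = 3 then 1 else 0) - 27 * (if e i = -3 then 1 else 0) := fun i => by
    rcases he i with h | h | h | h | h <;> rw [h] <;> norm_num
  rw [Finset.sum_congr rfl fun i _ => e1 i] at h1
  rw [Finset.sum_congr rfl fun i _ => e3 i] at h3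
  simp only [Finset.sum_add_distrib, Finset.sum_sub_distrib, ← Finset.mul_sum,
    Finset.sum_boole] at h1 h3
  have c1 : (Finset.univ.filter fun i => e i = 1).card
      = (Finset.univ.filter fun i => e i = -1).card := by
    have : ((Finset.univ.filter fun i => e i = 1).card : ℝ)
      = (Finset.univ.filter fun i => e i = -1).card := by linarith
    exact_mod_cast this
  have c3 : (Finset.univ.filter fun i => e i = 3).card
      = (Finset.univ.filter fun i => e i = -3).card := by
    have : ((Finset.univ.filter fun i => e i = 3).card : ℝ)
      = (Finset.univ.filter fun i => e i = -3).card := by linarith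
    exact_mod_cast this
  obtain ⟨k, hk⟩ := exists_perm_comp_eq e (fun i => - e i) fun a => by
    simp only [neg_eq_iff_eq_neg]
    by_cases h0 : a = 0
    · simp [h0]
    by_cases h1 : a = 1
    · rw [h1, c1]
    by_cases h1' : a = -1
    · rw [h1', neg_neg, c1]
    by_cases h3 : a = 3
    · rw [h3, c3]
    by_cases h3' : a = -3
    · rw [h3', neg_neg, c3]
    rw [Finset.filter_false_of_mem, Finset.filter_false_of_mem]
    · intro i _ h
      rcases he i with h' | h' | h' | h' | h' <;> rw [h'] at h
      · exact h0 (by linarith)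
      · exact h1' (by linarith)
      · exact h1 (by linarith)
      · exact h3' (by linarith)
      · exact h3 (by linarith)
    · intro i _ h
      rcases he i with h' | h' | h' | h' | h' <;> rw [h'] at h
      · exact h0 h.symm
      · exact h1 h.symm
      · exact h1' h.symm
      · exact h3 h.symm
      · exact h3' h.symm
  have hk' : ∀ i, e (k i) = - e i := fun i => by linarith [hk i]
  have hk2 : ∀ i, e (k.symm i) = - e i := fun i => by
    have := hk' (k.symm i)
    rw [Equiv.apply_symm_apply] at this
    linarith
  -- The permutation `k` negates `e` but need not be an involution; using `k` on positive values and
  -- its inverse on negative ones makes it one.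
  refine ⟨fun i => if 0 < e i then k i else if e i < 0 then k.symm i else i, fun i => ?_,
    fun i => ?_⟩
  · rcases lt_trichotomy (e i) 0 with h | h | h
    · simp [h, h.not_gt, hk2]
    · simp [h]
    · simp [h, h.not_gt, hk']
  · rcases lt_trichotomy (e i) 0 with h | h | h
    · simp [h, h.not_gt, hk2]
    · simp [h]
    · simp [h, hk']

theorem exists_swap {T : Matrix n n ℂ} (hT : Tᴴ = T)
    (h5 : T * T * T * T * T - (10 : ℂ) • (T * T * T) + (9 : ℂ) • T = 0) (t1 : T.trace = 0)
    (t3 : (T * T * T).trace = 0) :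
    ∃ P : Matrix n n ℂ, Pᴴ = P ∧ P * P = 1 ∧ P * T = -(T * P) := by
  obtain ⟨V, e, h1, h2, rfl⟩ := exists_unitary_diagonalization hT
  simp only [conj_mul_conj h1, trace_conj h1, Matrix.diagonal_mul_diagonal, Matrix.trace_diagonal] at h5 t1 t3
  -- The quintic is `T (T² - 1) (T² - 9)`.
  have he : ∀ i, e i = 0 ∨ e i = 1 ∨ e i = -1 ∨ e i = 3 ∨ e i = -3 := fun i => by
    have h6 : V * (Matrix.diagonal (fun i => (e i : ℂ) * e i * e i * e i * e i)
      - (10 : ℂ) • Matrix.diagonal (fun i => (e i : ℂ) * e i * e i)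
      + (9 : ℂ) • Matrix.diagonal (fun i => (e i : ℂ))) * Vᴴ = V * 0 * Vᴴ := by
      rw [mul_zero, zero_mul, ← h5]
      simp only [mul_add, mul_sub, add_mul, sub_mul, mul_smul_comm, smul_mul_assoc]
    have h7 := congrFun (congrFun (conj_injective h1 h6) i) i
    simp only [Matrix.add_apply, Matrix.sub_apply, Matrix.smul_apply, Matrix.diagonal_apply_eq, Matrix.zero_apply, smul_eq_mul] at h7
    have h8 : e i * (e i - 1) * (e i + 1) * (e i - 3) * (e i + 3) = 0 := by
      have : ((e i * (e i - 1) * (e i + 1) * (e i - 3) * (e i + 3) : ℝ) : ℂ) = 0 := by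
        rw [← h7]; push_cast; ring
      exact_mod_cast this
    simp only [mul_eq_zero, sub_eq_zero, add_eq_zero_iff_eq_neg] at h8
    tauto
  obtain ⟨p, hp, hpe⟩ := exists_swap_perm e he (by exact_mod_cast t1)
    (by
      have : ((∑ i, e i ^ 3 : ℝ) : ℂ) = 0 := by
        rw [← t3]; push_cast; exact Finset.sum_congr rfl fun i _ => by ring
      exact_mod_cast this)
  have hpp : ∀ i j, p i = j ↔ i = p j := fun i j =>
    ⟨fun h => by rw [← h, hp], fun h => by rw [h, hp]⟩
  set P : Matrix n n ℂ := Matrix.of fun i j => if p i = j then 1 else 0 with hP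
  refine ⟨V * P * Vᴴ, ?_, ?_, ?_⟩
  · rw [Matrix.conjTranspose_mul, Matrix.conjTranspose_mul, Matrix.conjTranspose_conjTranspose, ← mul_assoc]
    congr 2
    ext i j
    simp only [hP, Matrix.conjTranspose_apply, Matrix.of_apply, hpp j i, eq_comm (a := j)]
    split_ifs <;> simp
  · rw [conj_mul_conj h1]
    have : P * P = 1 := by
      ext i j
      rw [Matrix.mul_apply, Finset.sum_eq_single (p i)]
      · simp [hP, Matrix.one_apply, hp]
      · intro k _ hk
        simp [hP, Ne.symm hk]
      · simp
    rw [this, mul_one, h2]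
  · rw [conj_mul_conj h1, conj_mul_conj h1, ← neg_mul, ← mul_neg]
    congr 2
    ext i j
    rw [Matrix.neg_apply, Matrix.mul_diagonal, Matrix.diagonal_mul, hP, Matrix.of_apply]
    split_ifs with h
    · rw [← h, hpe]; simp
    · simp

end Spectral

/-! ### Reflections and common anticommuting partners. -/

/-- Hermitian involutions of trace zero. -/
structure IsRefl {n : Type*} [Fintype n] [DecidableEq n] (W : Matrix n n ℂ) : Prop where
  herm : Wᴴ = W
  sq : W * W = 1
  tr : W.trace = 0

theorem trace_eq_zero_of_anticomm {n : Type*} [Fintype n] [DecidableEq n] {Q W : Matrix n n ℂ}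
    (hW : W * W = 1) (h : Q * W = -(W * Q)) : Q.trace = 0 := by
  have h1 : (W * (Q * W)).trace = Q.trace := by
    rw [Matrix.trace_mul_comm, mul_assoc, hW, mul_one]
  rw [h, mul_neg, ← mul_assoc, hW, one_mul, Matrix.trace_neg] at h1
  linear_combination (-1 / 2 : ℂ) * h1

/-- Both `W` and `W'` anticommute with the Hermitian matrix `i[W, W']`, hence with its sign `S`,
which is an involution off the kernel. On the kernel, with projection `E = 1 - S²`, the two commute
and are still traceless, and an involution `P` negating both is found from their joint spectrum. The
two pieces are glued as `S + E * P`. -/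
theorem IsRefl.exists_anticomm {n : Type*} [Fintype n] [DecidableEq n] {W W' : Matrix n n ℂ}
    (h : IsRefl W) (h' : IsRefl W') :
    ∃ Q, IsRefl Q ∧ Q * W = -(W * Q) ∧ Q * W' = -(W' * Q) := by
  have sq := h.sq
  have sq' := h'.sq
  have hC : (Complex.I • (W * W' - W' * W))ᴴ = Complex.I • (W * W' - W' * W) := by
    rw [Matrix.conjTranspose_smul, Matrix.conjTranspose_sub, Matrix.conjTranspose_mul, Matrix.conjTranspose_mul, h.herm,
      h'.herm]
    simp only [RCLike.star_def, Complex.conj_I, neg_smul, smul_sub]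
    abel
  obtain ⟨S, hS, hS3, hE, hX⟩ := exists_sign hC
  have hSW : W * S = -(S * W) := hX W (by
    simp only [mul_smul_comm, smul_mul_assoc, mul_sub, sub_mul, ← mul_assoc, sq]
    simp only [mul_assoc, sq, one_mul, mul_one, ← smul_neg, neg_sub])
  have hSW' : W' * S = -(S * W') := hX W' (by
    simp only [mul_smul_comm, smul_mul_assoc, mul_sub, sub_mul, ← mul_assoc, sq']
    simp only [mul_assoc, sq', one_mul, mul_one, ← smul_neg, neg_sub])
  set E := 1 - S * S with hEdef
  have SE : S * E = 0 := by rw [hEdef, mul_sub, ← mul_assoc, hS3, mul_one, sub_self]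
  have ES : E * S = 0 := by rw [hEdef, sub_mul, hS3, one_mul, sub_self]
  have EE : E * E = E := by
    conv_lhs => rw [hEdef, sub_mul, mul_assoc, SE, mul_zero, one_mul, sub_zero]
  have EH : Eᴴ = E := by rw [hEdef, Matrix.conjTranspose_sub, Matrix.conjTranspose_mul, hS]; simp
  have comm : ∀ X, X * S = -(S * X) → X * E = E * X := fun X hX => by
    rw [hEdef, mul_sub, sub_mul, ← mul_assoc, hX, neg_mul, mul_assoc, hX, mul_neg, neg_neg,
      mul_one, one_mul, mul_assoc]
  have EW := comm W hSW
  have EW' := comm W' hSW'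
  have hcomm : E * (W * W') = E * (W' * W) := by
    rw [mul_smul_comm, smul_eq_zero] at hE
    rw [← sub_eq_zero, ← mul_sub]
    exact hE.resolve_left Complex.I_ne_zero
  -- Cyclicity gives `tr (S X S) = tr (S² X)`, while anticommutation gives the opposite sign, so
  -- `S²` carries no trace of `X`.
  have trE : ∀ X, X * S = -(S * X) → X.trace = 0 → (E * X).trace = 0 := fun X hX h0 => by
    have h1 : (S * (X * S)).trace = (S * S * X).trace := by
      rw [Matrix.trace_mul_comm, mul_assoc, Matrix.trace_mul_comm]
    rw [hX, mul_neg, Matrix.trace_neg, ← mul_assoc] at h1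
    rw [hEdef, sub_mul, one_mul, Matrix.trace_sub, h0]
    linear_combination (1 / 2 : ℂ) * h1
  obtain ⟨w, hw⟩ : ∃ w, w = E * W := ⟨_, rfl⟩
  obtain ⟨w', hw'⟩ : ∃ w', w' = E * W' := ⟨_, rfl⟩
  have ww : w * w = E := by
    rw [hw]; nth_rw 2 [← EW]; rw [mul_assoc, ← mul_assoc W, sq, one_mul, EE]
  have ww' : w' * w' = E := by
    rw [hw']; nth_rw 2 [← EW']; rw [mul_assoc, ← mul_assoc W', sq', one_mul, EE]
  have wE : w * E = w := by rw [hw, mul_assoc, EW, ← mul_assoc, EE]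
  have wE' : w' * E = w' := by rw [hw', mul_assoc, EW', ← mul_assoc, EE]
  have Ew : E * w = w := by rw [hw, ← mul_assoc, EE]
  have Ew' : E * w' = w' := by rw [hw', ← mul_assoc, EE]
  have cw : w' * w = w * w' := by
    rw [hw, hw', ← EW, ← EW', mul_assoc, mul_assoc, ← mul_assoc E, ← mul_assoc E, ← EW, ← EW',
      mul_assoc, mul_assoc, EE, ← mul_assoc, ← mul_assoc,
      show W' * W * E = E * (W' * W) by rw [mul_assoc, EW, ← mul_assoc, EW', mul_assoc],
      show W * W' * E = E * (W * W') by rw [mul_assoc, EW', ← mul_assoc, EW, mul_assoc], hcomm]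
  have wH : wᴴ = w := by rw [hw, Matrix.conjTranspose_mul, EH, h.herm, EW]
  have wH' : w'ᴴ = w' := by rw [hw', Matrix.conjTranspose_mul, EH, h'.herm, EW']
  have wt : w.trace = 0 := hw ▸ trE W hSW h.tr
  have wt' : w'.trace = 0 := hw' ▸ trE W' hSW' h'.tr
  -- On the range of `E` the values `±2 ± 1` of `T` separate the four joint eigenspaces of `w` and
  -- `w'`, so both are polynomials in `T`, and odd ones: negating `T` negates both.
  obtain ⟨T, hT⟩ : ∃ T, T = (2 : ℂ) • w + w' := ⟨_, rfl⟩
  have TT : T * T = (5 : ℂ) • E + (4 : ℂ) • (w * w') := by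
    rw [hT]
    simp only [add_mul, mul_add, smul_mul_assoc, mul_smul_comm, ww, ww', cw]
    module
  have T3 : T * T * T = (14 : ℂ) • w + (13 : ℂ) • w' := by
    rw [TT, hT]
    have e1 : w * w' * w = w' := by rw [mul_assoc, cw, ← mul_assoc, ww, Ew']
    have e2 : w * w' * w' = w := by rw [mul_assoc, ww', wE]
    simp only [add_mul, mul_add, smul_mul_assoc, mul_smul_comm, Ew, Ew', e1, e2]
    module
  have T5 : T * T * T * T * T = (122 : ℂ) • w + (121 : ℂ) • w' := by
    rw [mul_assoc (T * T * T), T3, TT]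
    have e1 : w' * (w * w') = w := by rw [← mul_assoc, cw, mul_assoc, ww', wE]
    have e2 : w * (w * w') = w' := by rw [← mul_assoc, ww, Ew']
    simp only [add_mul, mul_add, smul_mul_assoc, mul_smul_comm, wE, wE', e1, e2]
    module
  obtain ⟨P, PH, PP, PT⟩ := exists_swap (T := T) (by
      rw [hT, Matrix.conjTranspose_add, Matrix.conjTranspose_smul, wH, wH']; simp)
    (by rw [T5, T3, hT]; module) (by rw [hT, Matrix.trace_add, Matrix.trace_smul, wt, wt']; simp)
    (by rw [T3, Matrix.trace_add, Matrix.trace_smul, Matrix.trace_smul, wt, wt']; simp)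
  have PT3 : P * (T * T * T) = -(T * T * T * P) := by
    rw [← mul_assoc, ← mul_assoc, PT, neg_mul, neg_mul, mul_assoc T P, PT, mul_neg, neg_mul,
      neg_neg, ← mul_assoc, mul_assoc (T * T), PT, mul_neg, ← mul_assoc]
  have hw3 : w = (1 / 12 : ℂ) • ((13 : ℂ) • T - T * T * T) := by rw [T3, hT]; module
  have hw3' : w' = (1 / 6 : ℂ) • (T * T * T - (7 : ℂ) • T) := by rw [T3, hT]; module
  have Pw : P * w = -(w * P) := by
    rw [hw3]
    simp only [mul_smul_comm, smul_mul_assoc, mul_sub, sub_mul, PT, PT3]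
    module
  have Pw' : P * w' = -(w' * P) := by
    rw [hw3']
    simp only [mul_smul_comm, smul_mul_assoc, mul_sub, sub_mul, PT, PT3]
    module
  have PE : P * E = E * P := by
    rw [← ww, ← mul_assoc, Pw, neg_mul, mul_assoc, Pw, mul_neg, neg_neg, mul_assoc]
  have key : ∀ X, X * S = -(S * X) → X * E = E * X → P * (E * X) = -(E * X * P) →
      (S + E * P) * X = -(X * (S + E * P)) := fun X h1 h2 h3 => by
    rw [add_mul, mul_add, h1, ← PE, mul_assoc, h3, PE, ← mul_assoc, h2]
    abel
  have qW := key W hSW EW (hw ▸ Pw)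
  refine ⟨S + E * P, ⟨?_, ?_, trace_eq_zero_of_anticomm sq qW⟩, qW, key W' hSW' EW' (hw' ▸ Pw')⟩
  · rw [Matrix.conjTranspose_add, Matrix.conjTranspose_mul, hS, EH, PH, PE]
  · have e1 : E * P * (E * P) = E := by
      rw [mul_assoc, ← mul_assoc P, PE, mul_assoc, PP, mul_one, EE]
    have e2 : E * P * S = 0 := by rw [← PE, mul_assoc, ES, mul_zero]
    rw [add_mul, mul_add, mul_add, e1, e2, ← mul_assoc S, SE, zero_mul, hEdef]
    abel

/-! ### Balanced unitaries, which cost a single controlled gate. -/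

section Bal

variable {n : Type*} [Fintype n] [DecidableEq n]

/-- Trace zero makes the eigenvalues `1` and `-1` equally frequent, so any two reflections have the
same spectrum. -/
theorem IsRefl.exists_conj {W Z : Matrix n n ℂ} (hW : IsRefl W) (hZ : IsRefl Z) :
    ∃ V : Matrix n n ℂ, Vᴴ * V = 1 ∧ V * Vᴴ = 1 ∧ W = V * Z * Vᴴ := by
  obtain ⟨V, e, h1, h2, hWe⟩ := exists_unitary_diagonalization hW.herm
  obtain ⟨V', e', h1', h2', hZe⟩ := exists_unitary_diagonalization hZ.herm
  have half : ∀ {X U : Matrix n n ℂ} {f : n → ℝ}, IsRefl X → Uᴴ * U = 1 → U * Uᴴ = 1 →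
      X = U * Matrix.diagonal (fun i => (f i : ℂ)) * Uᴴ →
      (∀ i, f i = 1 ∨ f i = -1) ∧
      2 * ((Finset.univ.filter fun i => f i = 1).card : ℝ) = Fintype.card n ∧
      2 * ((Finset.univ.filter fun i => f i = -1).card : ℝ) = Fintype.card n := by
    intro X U f hX hU hU' he
    have hsq := hX.sq
    have htr := hX.tr
    rw [he, conj_mul_conj hU, Matrix.diagonal_mul_diagonal] at hsq
    rw [he, trace_conj hU, Matrix.trace_diagonal] at htr
    have hf : ∀ i, f i = 1 ∨ f i = -1 := fun i => by
      have : U * Matrix.diagonal (fun i => (f i : ℂ) * f i) * Uᴴ = U * 1 * Uᴴ := by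
        rw [hsq, mul_one, hU']
      have h3 := congrFun (congrFun (conj_injective hU this) i) i
      rw [Matrix.diagonal_apply_eq, Matrix.one_apply_eq] at h3
      have h4 : f i * f i = 1 := by exact_mod_cast h3
      exact mul_self_eq_one_iff.1 h4
    have hs : ∑ i, f i = 0 := by exact_mod_cast htr
    have e1 : ∀ i, f i = 2 * (if f i = 1 then 1 else 0) - 1 := fun i => by
      rcases hf i with h | h <;> rw [h] <;> norm_num
    have e2 : ∀ i, f i = 1 - 2 * (if f i = -1 then 1 else 0) := fun i => by
      rcases hf i with h | h <;> rw [h] <;> norm_num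
    have s1 := hs
    have s2 := hs
    rw [Finset.sum_congr rfl fun i _ => e1 i] at s1
    rw [Finset.sum_congr rfl fun i _ => e2 i] at s2
    simp only [Finset.sum_sub_distrib, ← Finset.mul_sum, Finset.sum_boole, Finset.sum_const,
      Finset.card_univ, nsmul_eq_mul, mul_one] at s1 s2
    exact ⟨hf, by linarith, by linarith⟩
  obtain ⟨hf, c1, c2⟩ := half hW h1 h2 hWe
  obtain ⟨hf', c1', c2'⟩ := half hZ h1' h2' hZe
  obtain ⟨p, hp⟩ := exists_perm_comp_eq e e' fun a => by
    by_cases ha : a = 1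
    · subst ha
      exact_mod_cast (by linarith : ((Finset.univ.filter fun i => e i = 1).card : ℝ)
        = (Finset.univ.filter fun i => e' i = 1).card)
    by_cases ha' : a = -1
    · subst ha'
      exact_mod_cast (by linarith : ((Finset.univ.filter fun i => e i = -1).card : ℝ)
        = (Finset.univ.filter fun i => e' i = -1).card)
    rw [Finset.filter_false_of_mem, Finset.filter_false_of_mem]
    · intro i _ h
      rcases hf' i with h' | h' <;> rw [h'] at h
      · exact ha h.symm
      · exact ha' h.symm
    · intro i _ h
      rcases hf i with h' | h' <;> rw [h'] at h
      · exact ha h.symm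
      · exact ha' h.symm
  set P : Matrix n n ℂ := p.permMatrix ℂ with hP
  have hPH : Pᴴ = (p⁻¹).permMatrix ℂ := Matrix.conjTranspose_permMatrix p
  have P1 : P * Pᴴ = 1 := by
    rw [hPH, hP, ← Matrix.permMatrix_mul, inv_mul_cancel, Matrix.permMatrix_one]
  have P2 : Pᴴ * P = 1 := by
    rw [hPH, hP, ← Matrix.permMatrix_mul, mul_inv_cancel, Matrix.permMatrix_one]
  have hD : P * Matrix.diagonal (fun i => (e' i : ℂ)) * Pᴴ
      = Matrix.diagonal (fun i => (e i : ℂ)) := by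
    have : P * Matrix.diagonal (fun i => (e' i : ℂ)) = Matrix.diagonal (fun i => (e i : ℂ)) * P := by
      ext i j
      rw [Matrix.mul_diagonal, Matrix.diagonal_mul, hP, Equiv.Perm.permMatrix,
        PEquiv.toMatrix_toPEquiv_apply, Pi.single_apply]
      split_ifs with h
      · rw [← hp i]
        rw [h, mul_comm]
      · simp
    rw [this, mul_assoc, P1, mul_one]
  refine ⟨V * P * V'ᴴ, ?_, ?_, ?_⟩
  · simp only [Matrix.conjTranspose_mul, Matrix.conjTranspose_conjTranspose]
    calc V' * (Pᴴ * Vᴴ) * (V * P * V'ᴴ) = V' * (Pᴴ * (Vᴴ * V) * P) * V'ᴴ := by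
          simp only [mul_assoc]
      _ = 1 := by rw [h1, mul_one, P2, mul_one, h2']
  · simp only [Matrix.conjTranspose_mul, Matrix.conjTranspose_conjTranspose]
    calc V * P * V'ᴴ * (V' * (Pᴴ * Vᴴ)) = V * (P * (V'ᴴ * V') * Pᴴ) * Vᴴ := by
          simp only [mul_assoc]
      _ = 1 := by rw [h1', mul_one, P1, mul_one, h2]
  · rw [hWe, hZe, ← hD]
    simp only [Matrix.conjTranspose_mul, Matrix.conjTranspose_conjTranspose]
    calc _ = V * P * ((1 : Matrix n n ℂ) * Matrix.diagonal (fun i => (e' i : ℂ)) * 1) * Pᴴ * Vᴴ := by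
          simp only [mul_assoc, one_mul]
      _ = _ := by rw [← h1']; simp only [mul_assoc]

/-- Unitary matrices of trace zero whose square is a scalar. -/
structure IsBal (F : Matrix n n ℂ) : Prop where
  left : Fᴴ * F = 1
  right : F * Fᴴ = 1
  sq : ∃ c : ℂ, F * F = c • 1
  tr : F.trace = 0

theorem IsRefl.isBal {W : Matrix n n ℂ} (h : IsRefl W) : IsBal W :=
  ⟨by rw [h.herm, h.sq], by rw [h.herm, h.sq], ⟨1, by rw [h.sq, one_smul]⟩, h.tr⟩

theorem unitary_mul {A B : Matrix n n ℂ} (hA : Aᴴ * A = 1) (hB : Bᴴ * B = 1) :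
    (A * B)ᴴ * (A * B) = 1 := by
  rw [Matrix.conjTranspose_mul, mul_assoc, ← mul_assoc Aᴴ, hA, one_mul, hB]

theorem mul_unitary {A B : Matrix n n ℂ} (hA : A * Aᴴ = 1) (hB : B * Bᴴ = 1) :
    (A * B) * (A * B)ᴴ = 1 := by
  rw [Matrix.conjTranspose_mul, mul_assoc, ← mul_assoc B, hB, one_mul, hA]

theorem IsBal.conjTranspose {F : Matrix n n ℂ} (h : IsBal F) : IsBal Fᴴ := by
  obtain ⟨c, hc⟩ := h.sq
  refine ⟨by simpa using h.right, by simpa using h.left, ⟨star c, ?_⟩, ?_⟩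
  · rw [← Matrix.conjTranspose_mul, hc, Matrix.conjTranspose_smul, Matrix.conjTranspose_one]
  · rw [Matrix.trace_conjTranspose, h.tr, star_zero]

theorem IsBal.conj {F A : Matrix n n ℂ} (h : IsBal F) (h1 : Aᴴ * A = 1) (h2 : A * Aᴴ = 1) :
    IsBal (Aᴴ * F * A) := by
  obtain ⟨c, hc⟩ := h.sq
  have h2' : Aᴴᴴ * Aᴴ = 1 := by simpa using h2
  have h1' : Aᴴ * Aᴴᴴ = 1 := by simpa using h1
  have key := conj_mul_conj h2' F F
  have tr := trace_conj h2' F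
  rw [Matrix.conjTranspose_conjTranspose] at key tr
  refine ⟨unitary_mul (unitary_mul h2' h.left) h1, mul_unitary (mul_unitary h1' h.right) h2,
    ⟨c, ?_⟩, by rw [tr, h.tr]⟩
  rw [key, hc, mul_smul_comm, smul_mul_assoc, mul_one, h1]

theorem isBal_of_eq_smul {F Q : Matrix n n ℂ} {k : ℂ} (h1 : Fᴴ * F = 1) (h2 : F * Fᴴ = 1)
    (hQ : IsBal Q) (h : F = k • Q) : IsBal F := by
  obtain ⟨c, hc⟩ := hQ.sq
  refine ⟨h1, h2, ⟨k * k * c, ?_⟩, ?_⟩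
  · rw [h, smul_mul_smul_comm, hc, smul_smul]
  · rw [h, Matrix.trace_smul, hQ.tr, smul_zero]

theorem trace_mul_eq_zero_of_anticomm {Q v : Matrix n n ℂ} (h : Q * v = -(v * Q)) :
    (Q * v).trace = 0 := by
  have h1 := congrArg Matrix.trace h
  rw [Matrix.trace_neg, Matrix.trace_mul_comm v] at h1
  linear_combination (1 / 2 : ℂ) * h1

/-- Conjugation by `Q` turns `x + v` into `x - v`, so `(U * Q)² = (x + v)(x - v) = x² - q`. This is
the main source of balanced factors. -/
theorem isBal_mul_refl {Q U v : Matrix n n ℂ} {x q : ℂ} (h1 : Uᴴ * U = 1) (h2 : U * Uᴴ = 1)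
    (hQ : IsRefl Q) (hU : U = x • 1 + v) (hv : v * v = q • 1) (h : Q * v = -(v * Q)) :
    IsBal (U * Q) := by
  have hb := hQ.isBal
  refine ⟨unitary_mul h1 hb.left, mul_unitary h2 hb.right, ⟨x * x - q, ?_⟩, ?_⟩
  · have : Q * U * Q = x • 1 - v := by
      rw [hU, mul_add, add_mul, mul_smul_comm, mul_one, smul_mul_assoc, h, neg_mul, mul_assoc,
        hQ.sq, mul_one, sub_eq_add_neg]
    rw [mul_assoc, ← mul_assoc Q, this, hU, add_mul, mul_sub, mul_sub, hv]
    simp only [smul_mul_assoc, mul_smul_comm, one_mul, mul_one]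
    module
  · rw [Matrix.trace_mul_comm, hU, mul_add, Matrix.trace_add, mul_smul_comm, mul_one,
      Matrix.trace_smul, hQ.tr, trace_mul_eq_zero_of_anticomm h]
    simp

theorem isBal_refl_mul {Q U v : Matrix n n ℂ} {x q : ℂ} (h1 : Uᴴ * U = 1) (h2 : U * Uᴴ = 1)
    (hQ : IsRefl Q) (hU : U = x • 1 + v) (hv : v * v = q • 1) (h : Q * v = -(v * Q)) :
    IsBal (Q * U) := by
  have hb := hQ.isBal
  obtain ⟨c, hc⟩ := (isBal_mul_refl h1 h2 hQ hU hv h).sq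
  refine ⟨unitary_mul hb.left h1, mul_unitary hb.right h2, ⟨c, ?_⟩, ?_⟩
  · calc Q * U * (Q * U) = Q * (U * Q * (U * Q)) * Q := by
          simp only [mul_assoc, hQ.sq, mul_one]
      _ = c • 1 := by rw [hc, mul_smul_comm, smul_mul_assoc, mul_one, hQ.sq]
  · rw [Matrix.trace_mul_comm, (isBal_mul_refl h1 h2 hQ hU hv h).tr]

theorem IsBal.mul_of_anticomm {Q W : Matrix n n ℂ} (hQ : IsRefl Q) (hW : IsRefl W)
    (h : Q * W = -(W * Q)) : IsBal (Q * W) :=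
  isBal_refl_mul (x := 0) (q := 1) hW.isBal.left hW.isBal.right hQ (by simp)
    (by rw [hW.sq, one_smul]) h

/-- `B` differs from `A` by a product of two balanced unitaries. -/
def Factors (A B : Matrix n n ℂ) : Prop := ∃ F G, IsBal F ∧ IsBal G ∧ B = A * F * G

theorem Factors.of_eq {A B F G : Matrix n n ℂ} (h2 : A * Aᴴ = 1) (hF : IsBal F) (hG : IsBal G)
    (h : Aᴴ * B = F * G) : Factors A B :=
  ⟨F, G, hF, hG, by rw [mul_assoc, ← h, ← mul_assoc, h2, one_mul]⟩

theorem Factors.of_conjTranspose {A B : Matrix n n ℂ} (h1 : Aᴴ * A = 1) (h2 : A * Aᴴ = 1)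
    (h : Factors Aᴴ Bᴴ) : Factors A B := by
  obtain ⟨F, G, hF, hG, e⟩ := h
  refine ⟨_, _, hG.conjTranspose.conj h1 h2, hF.conjTranspose.conj h1 h2, ?_⟩
  have := congrArg Matrix.conjTranspose e
  simp only [Matrix.conjTranspose_mul, Matrix.conjTranspose_conjTranspose] at this
  calc B = (A * Aᴴ) * Gᴴ * (A * Aᴴ) * Fᴴ * A := by rw [this, h2]; simp [mul_assoc]
    _ = _ := by simp only [mul_assoc]

theorem Factors.of_eq_smul {A B G : Matrix n n ℂ} {Q : Matrix n n ℂ} {k : ℂ}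
    (h1 : Aᴴ * A = 1) (h2 : A * Aᴴ = 1) (h1' : Bᴴ * B = 1) (h2' : B * Bᴴ = 1)
    (hQ : IsBal Q) (hG : IsBal G) (h : B = k • (A * Q * G)) : Factors A B := by
  have hF : Aᴴ * B * Gᴴ = k • Q := by
    rw [h, mul_smul_comm, smul_mul_assoc]
    congr 1
    calc _ = (Aᴴ * A) * Q * (G * Gᴴ) := by simp only [mul_assoc]
      _ = Q := by rw [h1, hG.right]; simp
  refine Factors.of_eq h2 (isBal_of_eq_smul ?_ ?_ hQ hF) hG ?_
  · exact unitary_mul (unitary_mul (by simpa using h2) h1') (by simpa using hG.right)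
  · exact mul_unitary (mul_unitary (by simpa using h1) h2') (by simpa using hG.left)
  · rw [mul_assoc, hG.left, mul_one]

/-- As `U * (x - v) = x² - q`, unitarity identifies `Uᴴ` with a multiple of `x - v` when `x² ≠ q`.
Comparing traceless parts makes `vᴴ` a multiple of `v`, and dividing `v` by a square root of `q`
leaves a Hermitian involution. -/
theorem exists_smul_refl [Nonempty n] {U v : Matrix n n ℂ} {x q : ℂ} (h1 : Uᴴ * U = 1)
    (hU : U = x • 1 + v) (hv : v * v = q • 1) (ht : v.trace = 0) :
    v = 0 ∨ ∃ (k : ℂ) (W : Matrix n n ℂ), IsRefl W ∧ v = k • W := by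
  have hd : (Fintype.card n : ℂ) ≠ 0 := by simp
  have e1 : U * (x • 1 - v) = (x * x - q) • 1 := by
    rw [hU, add_mul, mul_sub, mul_sub, hv]
    simp only [smul_mul_assoc, mul_smul_comm, one_mul, mul_one]
    module
  by_cases hδ : x * x - q = 0
  · left
    rw [hδ, zero_smul] at e1
    have e2 : x • 1 - v = 0 := by
      calc x • 1 - v = Uᴴ * U * (x • 1 - v) := by rw [h1, one_mul]
        _ = 0 := by rw [mul_assoc, e1, mul_zero]
    have e3 := congrArg Matrix.trace e2
    simp only [Matrix.trace_sub, Matrix.trace_smul, Matrix.trace_one, ht, smul_eq_mul, sub_zero,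
      Matrix.trace_zero] at e3
    have hx : x = 0 := (mul_eq_zero.1 e3).resolve_right hd
    rw [hx] at e2
    simpa using e2
  set δ := x * x - q with hδdef
  have e2 : δ • Uᴴ = x • 1 - v := by
    calc δ • Uᴴ = Uᴴ * (δ • 1) := by simp
      _ = _ := by rw [← e1, ← mul_assoc, h1, one_mul]
  have e3 : δ * star x = x := by
    have := congrArg Matrix.trace e2
    rw [hU] at this
    simp only [Matrix.conjTranspose_add, Matrix.conjTranspose_smul, Matrix.conjTranspose_one,
      Matrix.trace_sub, Matrix.trace_add, Matrix.trace_smul, Matrix.trace_conjTranspose,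
      Matrix.trace_one, ht, star_zero, smul_eq_mul, sub_zero, add_zero] at this
    exact mul_right_cancel₀ hd (by rw [← this]; ring)
  have e4 : δ • vᴴ = -v := by
    rw [hU] at e2
    simp only [Matrix.conjTranspose_add, Matrix.conjTranspose_smul, Matrix.conjTranspose_one,
      smul_add, smul_smul, e3] at e2
    rw [eq_comm, sub_eq_add_neg] at e2
    exact (add_left_cancel e2).symm
  by_cases hv0 : v = 0
  · exact Or.inl hv0
  right
  have e5 : vᴴ * v = (-(q / δ)) • 1 := by
    have : δ • (vᴴ * v) = (-q) • 1 := by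
      rw [← smul_mul_assoc, e4, neg_mul, hv, neg_smul]
    rw [← inv_smul_smul₀ hδ (vᴴ * v), this, smul_smul]
    congr 1
    field_simp
  have hq : q ≠ 0 := by
    rintro rfl
    exact hv0 (Matrix.conjTranspose_mul_self_eq_zero.1 (by rw [e5]; simp))
  obtain ⟨k, hk⟩ := IsAlgClosed.exists_eq_mul_self q
  have hk0 : k ≠ 0 := by
    rintro rfl
    exact hq (by rw [hk, mul_zero])
  set W := k⁻¹ • v with hW
  have hvW : v = k • W := by rw [hW, smul_inv_smul₀ hk0]
  have WW : W * W = 1 := by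
    rw [hW, smul_mul_smul_comm, hv, hk, smul_smul]
    field_simp
    simp
  obtain ⟨s, hs⟩ : ∃ s : ℂ, Wᴴ * W = s • 1 :=
    ⟨_, by rw [hW, Matrix.conjTranspose_smul, smul_mul_smul_comm, e5, smul_smul]⟩
  have hWs : Wᴴ = s • W := by
    rw [← mul_one Wᴴ, ← WW, ← mul_assoc, hs, smul_mul_assoc, one_mul]
  obtain ⟨i⟩ := ‹Nonempty n›
  have hi := congrFun (congrFun hs i) i
  -- A diagonal entry of `Wᴴ * W` is a sum of squared moduli. Together with `s² = 1` this excludes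
  -- `s = -1`, the skew-Hermitian case.
  have hpos : 0 ≤ s := by
    rw [Matrix.smul_apply, Matrix.one_apply_eq, smul_eq_mul, mul_one, Matrix.mul_apply] at hi
    rw [← hi]
    exact Finset.sum_nonneg fun j _ => by
      rw [Matrix.conjTranspose_apply]
      exact star_mul_self_nonneg _
  have hss : star s = s := (IsSelfAdjoint.of_nonneg hpos)
  have hs2 : s * s = 1 := by
    have h3 : W = (s * s) • W := by
      conv_lhs => rw [← Matrix.conjTranspose_conjTranspose W, hWs, Matrix.conjTranspose_smul, hss,
        hWs, smul_smul]
    have h4 : (s * s - 1) • W = 0 := by rw [sub_smul, one_smul, ← h3, sub_self]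
    rcases smul_eq_zero.1 h4 with h | h
    · exact sub_eq_zero.1 h
    · exact absurd (by rw [hvW, h, smul_zero]) hv0
  have hs1 : s = 1 := by
    rcases mul_self_eq_one_iff.1 hs2 with h | h
    · exact h
    · rw [h] at hpos
      norm_num [Complex.le_def] at hpos
  refine ⟨k, W, ⟨by rw [hWs, hs1, one_smul], WW, ?_⟩, hvW⟩
  rw [hW, Matrix.trace_smul, ht, smul_zero]

end Bal

/-! ### One-qubit gates through the conjugates of `Z`, that is, through Bloch vectors. -/

section Qubit

/-- The conjugate of `Z` by `u`. -/
def conjZ (u : Matrix (Fin 2) (Fin 2) ℂ) : Matrix (Fin 2) (Fin 2) ℂ := u * pauliZ * uᴴ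

/-- One-qubit unitaries. -/
structure IsUni (u : Matrix (Fin 2) (Fin 2) ℂ) : Prop where
  left : uᴴ * u = 1
  right : u * uᴴ = 1

/-- Diagonal or anti-diagonal one-qubit operators. -/
def DiagOrAnti (u : Matrix (Fin 2) (Fin 2) ℂ) : Prop :=
  (u 0 1 = 0 ∧ u 1 0 = 0) ∨ (u 0 0 = 0 ∧ u 1 1 = 0)

theorem IsUni.conjTranspose {u : Matrix (Fin 2) (Fin 2) ℂ} (h : IsUni u) : IsUni uᴴ :=
  ⟨by simpa using h.right, by simpa using h.left⟩

theorem IsUni.mul {u v : Matrix (Fin 2) (Fin 2) ℂ} (h : IsUni u) (k : IsUni v) : IsUni (u * v) :=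
  ⟨unitary_mul h.left k.left, mul_unitary h.right k.right⟩

theorem DiagOrAnti.of_conjTranspose {u : Matrix (Fin 2) (Fin 2) ℂ} (h : DiagOrAnti uᴴ) :
    DiagOrAnti u := by
  simpa [DiagOrAnti, and_comm] using h

theorem DiagOrAnti.conjTranspose {u : Matrix (Fin 2) (Fin 2) ℂ} (h : DiagOrAnti u) :
    DiagOrAnti uᴴ := .of_conjTranspose (by simpa using h)

theorem pauliZ_sq : pauliZ * pauliZ = 1 := by
  ext i j; fin_cases i <;> fin_cases j <;> simp [pauliZ, Matrix.mul_apply]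

theorem pauliZ_herm : pauliZᴴ = pauliZ := by
  ext i j; fin_cases i <;> fin_cases j <;> simp [pauliZ]

theorem conjZ_herm (u : Matrix (Fin 2) (Fin 2) ℂ) : (conjZ u)ᴴ = conjZ u := by
  simp [conjZ, Matrix.conjTranspose_mul, pauliZ_herm, mul_assoc]

theorem IsUni.conjZ_sq {u : Matrix (Fin 2) (Fin 2) ℂ} (h : IsUni u) : conjZ u * conjZ u = 1 := by
  rw [conjZ, conj_mul_conj h.left, pauliZ_sq, mul_one, h.right]

theorem IsUni.conjZ_one_one {u : Matrix (Fin 2) (Fin 2) ℂ} (h : IsUni u) :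
    conjZ u 1 1 = - conjZ u 0 0 := by
  have h1 := trace_conj h.left pauliZ
  have h2 : pauliZ.trace = 0 := by simp [pauliZ, Matrix.trace_fin_two]
  rw [h2, Matrix.trace_fin_two] at h1
  exact (neg_eq_of_add_eq_zero_right h1).symm

theorem conjZ_apply (u : Matrix (Fin 2) (Fin 2) ℂ) (i j : Fin 2) :
    conjZ u i j = u i 0 * star (u j 0) - u i 1 * star (u j 1) := by
  simp [conjZ, Matrix.mul_apply, pauliZ, Fin.sum_univ_two, sub_eq_add_neg]

theorem IsUni.row {u : Matrix (Fin 2) (Fin 2) ℂ} (h : IsUni u) (i j : Fin 2) :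
    u i 0 * star (u j 0) + u i 1 * star (u j 1) = if i = j then 1 else 0 := by
  have := congrFun (congrFun h.right i) j
  simpa [Matrix.mul_apply, Fin.sum_univ_two, Matrix.one_apply] using this

/-- The off-diagonal entry of `conjZ u` is the difference of the two products whose sum vanishes by
orthogonality of the rows, so both products vanish. -/
theorem IsUni.diagOrAnti {u : Matrix (Fin 2) (Fin 2) ℂ} (h : IsUni u) (h0 : conjZ u 0 1 = 0) :
    DiagOrAnti u := by
  rw [conjZ_apply] at h0
  have h1 : u 0 0 * star (u 0 0) + u 0 1 * star (u 0 1) = 1 := by simpa using h.row 0 0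
  have h2 : u 0 0 * star (u 1 0) + u 0 1 * star (u 1 1) = 0 := by simpa using h.row 0 1
  have h3 : u 1 0 * star (u 1 0) + u 1 1 * star (u 1 1) = 1 := by simpa using h.row 1 1
  have h4 : u 0 0 * star (u 1 0) = 0 := by linear_combination (1 / 2 : ℂ) * (h0 + h2)
  have h5 : u 0 1 * star (u 1 1) = 0 := by linear_combination (1 / 2 : ℂ) * (h2 - h0)
  rcases mul_eq_zero.1 h4 with h6 | h6
  · right
    refine ⟨h6, ?_⟩
    rcases mul_eq_zero.1 h5 with h7 | h7
    · rw [h6, h7] at h1; simp at h1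
    · exact star_eq_zero.1 h7
  · left
    refine ⟨?_, star_eq_zero.1 h6⟩
    rcases mul_eq_zero.1 h5 with h7 | h7
    · exact h7
    · rw [h6, h7] at h3; simp at h3

theorem IsUni.conjZ_conjTranspose {u : Matrix (Fin 2) (Fin 2) ℂ} (h : IsUni u) :
    conjZ uᴴ 0 0 = conjZ u 0 0 := by
  have h1 : u 0 0 * star (u 0 0) + u 0 1 * star (u 0 1) = 1 := by simpa using h.row 0 0
  have h2 : star (u 0 0) * u 0 0 + star (u 1 0) * u 1 0 = 1 := by
    simpa using h.conjTranspose.row 0 0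
  rw [conjZ_apply, conjZ_apply]
  simp only [Matrix.conjTranspose_apply, star_star]
  linear_combination h1 - h2

/-- The part of `conjZ (u * v)` coming from the diagonal part of `conjZ v`. -/
def axial (u v : Matrix (Fin 2) (Fin 2) ℂ) : Matrix (Fin 2) (Fin 2) ℂ := conjZ v 0 0 • conjZ u

/-- The part of `conjZ (u * v)` coming from the off-diagonal part of `conjZ v`. -/
def planar (u v : Matrix (Fin 2) (Fin 2) ℂ) : Matrix (Fin 2) (Fin 2) ℂ :=
  u * (conjZ v - conjZ v 0 0 • pauliZ) * uᴴ

theorem conjZ_real (u : Matrix (Fin 2) (Fin 2) ℂ) (i : Fin 2) : star (conjZ u i i) = conjZ u i i := by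
  conv_rhs => rw [← conjZ_herm u, Matrix.conjTranspose_apply]

theorem axial_herm (u v : Matrix (Fin 2) (Fin 2) ℂ) : (axial u v)ᴴ = axial u v := by
  rw [axial, Matrix.conjTranspose_smul, conjZ_herm, conjZ_real]

theorem planar_herm (u v : Matrix (Fin 2) (Fin 2) ℂ) : (planar u v)ᴴ = planar u v := by
  simp only [planar, Matrix.conjTranspose_mul, Matrix.conjTranspose_sub,
    Matrix.conjTranspose_smul, Matrix.conjTranspose_conjTranspose, conjZ_herm, pauliZ_herm,
    conjZ_real, mul_assoc]

theorem axial_add_planar (u v : Matrix (Fin 2) (Fin 2) ℂ) :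
    axial u v + planar u v = conjZ (u * v) := by
  rw [axial, planar, mul_sub, sub_mul, mul_smul_comm, smul_mul_assoc, ← conjZ, add_sub_cancel]
  simp [conjZ, Matrix.conjTranspose_mul, mul_assoc]

theorem IsUni.axial_one_one {u : Matrix (Fin 2) (Fin 2) ℂ} (h : IsUni u)
    (v : Matrix (Fin 2) (Fin 2) ℂ) : axial u v 1 1 = - axial u v 0 0 := by
  simp [axial, h.conjZ_one_one]

theorem IsUni.planar_one_one {u v : Matrix (Fin 2) (Fin 2) ℂ} (h : IsUni u) (k : IsUni v) :
    planar u v 1 1 = - planar u v 0 0 := by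
  have h1 := congrFun (congrFun (axial_add_planar u v) 0) 0
  have h2 := congrFun (congrFun (axial_add_planar u v) 1) 1
  rw [Matrix.add_apply] at h1 h2
  rw [(h.mul k).conjZ_one_one, ← h1, h.axial_one_one] at h2
  linear_combination h2

/-- Orthogonality of the Bloch vectors of the two parts: `Z` anticommutes with off-diagonal
matrices, and conjugating by `u` preserves this. -/
theorem IsUni.axial_planar {u v : Matrix (Fin 2) (Fin 2) ℂ} (h : IsUni u) (k : IsUni v) :
    2 * (axial u v 0 0 * planar u v 0 0) + axial u v 0 1 * star (planar u v 0 1)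
      + planar u v 0 1 * star (axial u v 0 1) = 0 := by
  have h1 : axial u v * planar u v + planar u v * axial u v = 0 := by
    rw [axial, planar, smul_mul_assoc, mul_smul_comm,
      show conjZ u = u * pauliZ * uᴴ from rfl, conj_mul_conj h.left,
      conj_mul_conj h.left, ← smul_add, ← add_mul, ← mul_add]
    have : pauliZ * (conjZ v - conjZ v 0 0 • pauliZ) + (conjZ v - conjZ v 0 0 • pauliZ) * pauliZ
        = 0 := by
      have e00 : (conjZ v - conjZ v 0 0 • pauliZ) 0 0 = 0 := by simp [pauliZ]
      have e11 : (conjZ v - conjZ v 0 0 • pauliZ) 1 1 = 0 := by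
        simp [pauliZ, k.conjZ_one_one]
      generalize conjZ v - conjZ v 0 0 • pauliZ = o at e00 e11 ⊢
      refine Matrix.ext fun i j => ?_
      rw [Matrix.add_apply, Matrix.mul_apply, Matrix.mul_apply, Fin.sum_univ_two,
        Fin.sum_univ_two]
      fin_cases i <;> fin_cases j <;> simp [pauliZ, e00, e11]
    rw [this]; simp
  have h2 := congrFun (congrFun h1 0) 0
  simp only [Matrix.add_apply, Matrix.mul_apply, Fin.sum_univ_two, Matrix.zero_apply] at h2
  have h3 : axial u v 1 0 = star (axial u v 0 1) := by
    conv_lhs => rw [← axial_herm, Matrix.conjTranspose_apply]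
  have h4 : planar u v 1 0 = star (planar u v 0 1) := by
    conv_lhs => rw [← planar_herm, Matrix.conjTranspose_apply]
  rw [h3, h4] at h2
  linear_combination h2

theorem eq_zero_of_herm {a : Matrix (Fin 2) (Fin 2) ℂ} (h : aᴴ = a) (h1 : a 1 1 = - a 0 0)
    (h00 : a 0 0 = 0) (h01 : a 0 1 = 0) : a = 0 := by
  have h10 : a 1 0 = 0 := by rw [← h, Matrix.conjTranspose_apply, h01, star_zero]
  ext i j; fin_cases i <;> fin_cases j <;> simp [h1, h00, h01, h10]

theorem IsUni.conjZ_eq_zero_of_axial {u v : Matrix (Fin 2) (Fin 2) ℂ} (h : IsUni u)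
    (h00 : axial u v 0 0 = 0) (h01 : axial u v 0 1 = 0) : conjZ v 0 0 = 0 := by
  have h1 := eq_zero_of_herm (axial_herm u v) (h.axial_one_one v) h00 h01
  rw [axial, smul_eq_zero] at h1
  refine h1.resolve_right fun h2 => ?_
  have h3 := h.conjZ_sq
  rw [h2, mul_zero] at h3
  exact zero_ne_one h3

theorem IsUni.diagOrAnti_of_planar {u v : Matrix (Fin 2) (Fin 2) ℂ} (h : IsUni u) (k : IsUni v)
    (h00 : planar u v 0 0 = 0) (h01 : planar u v 0 1 = 0) :
    DiagOrAnti v ∧ conjZ v 0 0 ≠ 0 := by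
  have h1 := eq_zero_of_herm (planar_herm u v) (h.planar_one_one k) h00 h01
  have h2 : conjZ v - conjZ v 0 0 • pauliZ = 0 := conj_injective h.left (by
    rw [← planar, h1]; simp)
  have h3 := congrFun (congrFun h2 0) 1
  refine ⟨k.diagOrAnti (by simpa [pauliZ] using h3), fun h4 => ?_⟩
  rw [h4, zero_smul, sub_zero] at h2
  have h5 := k.conjZ_sq
  rw [h2, mul_zero] at h5
  exact zero_ne_one h5

theorem IsUni.diagOrAnti_of_axial {u v : Matrix (Fin 2) (Fin 2) ℂ} (h : IsUni u)
    (hv : conjZ v 0 0 ≠ 0) (h01 : axial u v 0 1 = 0) : DiagOrAnti u := by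
  rw [axial, Matrix.smul_apply, smul_eq_mul, mul_eq_zero] at h01
  exact h.diagOrAnti (h01.resolve_left hv)

end Qubit

/-! ### The algebra generated by two reflections with scalar anticommutator. -/

section Span

variable {n : Type*} [Fintype n] [DecidableEq n]

/-- Linear combinations of `1`, `W`, `W'` and `W * W'`. -/
def InSpan (W W' Y : Matrix n n ℂ) : Prop :=
  ∃ x y z t : ℂ, Y = x • 1 + y • W + z • W' + t • (W * W')

variable {W W' Y Y' : Matrix n n ℂ} {s : ℂ}

theorem InSpan.add (h : InSpan W W' Y) (h' : InSpan W W' Y') : InSpan W W' (Y + Y') := by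
  obtain ⟨x, y, z, t, rfl⟩ := h
  obtain ⟨x', y', z', t', rfl⟩ := h'
  exact ⟨x + x', y + y', z + z', t + t', by module⟩

theorem InSpan.smul (h : InSpan W W' Y) (c : ℂ) : InSpan W W' (c • Y) := by
  obtain ⟨x, y, z, t, rfl⟩ := h
  exact ⟨c * x, c * y, c * z, c * t, by module⟩

theorem inSpan_one : InSpan W W' 1 := ⟨1, 0, 0, 0, by module⟩
theorem inSpan_zero : InSpan W W' 0 := ⟨0, 0, 0, 0, by module⟩
theorem inSpan_left : InSpan W W' W := ⟨0, 1, 0, 0, by module⟩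
theorem inSpan_right : InSpan W W' W' := ⟨0, 0, 1, 0, by module⟩

theorem InSpan.mul (hW : W * W = 1) (hW' : W' * W' = 1) (hs : W * W' + W' * W = s • 1)
    (h : InSpan W W' Y) (h' : InSpan W W' Y') : InSpan W W' (Y * Y') := by
  obtain ⟨x, y, z, t, rfl⟩ := h
  obtain ⟨x', y', z', t', rfl⟩ := h'
  have e : W' * W = s • 1 - W * W' := eq_sub_of_add_eq' hs
  have e1 : W * W' * W = s • W - W' := by
    rw [mul_assoc, e, mul_sub, ← mul_assoc, hW]; simp
  have e2 : W * W' * W' = W := by rw [mul_assoc, hW', mul_one]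
  have e3 : W * (W * W') = W' := by rw [← mul_assoc, hW, one_mul]
  have e4 : W' * (W * W') = s • W' - W := by
    rw [← mul_assoc, e, sub_mul, mul_assoc, hW']; simp
  have e5 : W * W' * (W * W') = s • (W * W') - 1 := by
    rw [mul_assoc, e4, mul_sub, hW, mul_smul_comm]
  refine ⟨x * x' + y * y' + z * z' + s * z * y' - t * t',
    x * y' + y * x' + s * t * y' + t * z' - z * t',
    x * z' + z * x' + y * t' - t * y' + s * z * t',
    x * t' + t * x' + y * z' - z * y' + s * t * t', ?_⟩
  simp only [mul_add, add_mul, smul_mul_assoc, mul_smul_comm, one_mul, mul_one, hW, hW', e, e1,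
    e2, e3, e4, e5]
  module

theorem InSpan.conjTranspose (h1 : Wᴴ = W) (h1' : W'ᴴ = W')
    (hs : W * W' + W' * W = s • 1) (h : InSpan W W' Y) : InSpan W W' Yᴴ := by
  obtain ⟨x, y, z, t, rfl⟩ := h
  have e : W' * W = s • 1 - W * W' := eq_sub_of_add_eq' hs
  refine ⟨star x + star t * s, star y, star z, -star t, ?_⟩
  simp only [Matrix.conjTranspose_add, Matrix.conjTranspose_smul, Matrix.conjTranspose_mul,
    Matrix.conjTranspose_one, h1, h1', e]
  module

/-- The span is a quaternion-like algebra containing `U = Aᴴ * B`. Splitting `U` into a scalar and a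
traceless `v` of scalar square, and choosing a reflection `Q` anticommuting with `v`, one writes `U
= (U * Q) * Q`. -/
theorem factors_of_inSpan [Nonempty n] {A B : Matrix n n ℂ} (hW : IsRefl W) (hW' : IsRefl W')
    (hs : W * W' + W' * W = s • 1) (hA1 : Aᴴ * A = 1) (hA2 : A * Aᴴ = 1) (hB1 : Bᴴ * B = 1)
    (hB2 : B * Bᴴ = 1) (hA : InSpan W W' A) (hB : InSpan W W' B) : Factors A B := by
  obtain ⟨x, y, z, t, hU⟩ := (hA.conjTranspose hW.herm hW'.herm hs).mul hW.sq hW'.sq hs hB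
  have u1 : (Aᴴ * B)ᴴ * (Aᴴ * B) = 1 := unitary_mul (by simpa using hA2) hB1
  have u2 : (Aᴴ * B) * (Aᴴ * B)ᴴ = 1 := mul_unitary (by simpa using hA1) hB2
  -- Subtracting `s / 2` removes the trace of `W * W'` and makes the three generators of `v` square
  -- to scalars with scalar mutual anticommutators.
  set v := y • W + z • W' + t • (W * W' - (s / 2) • 1) with hv
  have hUv : Aᴴ * B = (x + t * s / 2) • 1 + v := by rw [hU, hv]; module
  have e : W' * W = s • 1 - W * W' := eq_sub_of_add_eq' hs
  have vv : v * v = (y * y + z * z + s * y * z + t * t * (s * s / 4 - 1)) • 1 := by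
    have e1 : W * W' * W = s • W - W' := by
      rw [mul_assoc, e, mul_sub, ← mul_assoc, hW.sq]; simp
    have e2 : W * W' * W' = W := by rw [mul_assoc, hW'.sq, mul_one]
    have e3 : W * (W * W') = W' := by rw [← mul_assoc, hW.sq, one_mul]
    have e4 : W' * (W * W') = s • W' - W := by
      rw [← mul_assoc, e, sub_mul, mul_assoc, hW'.sq]; simp
    have e5 : W * W' * (W * W') = s • (W * W') - 1 := by
      rw [mul_assoc, e4, mul_sub, hW.sq, mul_smul_comm]
    rw [hv]
    simp only [mul_add, add_mul, mul_sub, sub_mul, smul_mul_assoc, mul_smul_comm, one_mul,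
      mul_one, hW.sq, hW'.sq, e, e1, e2, e3, e4, e5]
    module
  have tv : v.trace = 0 := by
    have h1 := congrArg Matrix.trace hs
    rw [Matrix.trace_add, Matrix.trace_mul_comm W'] at h1
    simp only [Matrix.trace_smul, smul_eq_mul] at h1
    rw [hv]
    simp only [Matrix.trace_add, Matrix.trace_sub, Matrix.trace_smul, smul_eq_mul, hW.tr, hW'.tr]
    linear_combination t / 2 * h1
  obtain ⟨Q, hQ, hQv⟩ : ∃ Q, IsRefl Q ∧ Q * v = -(v * Q) := by
    rcases exists_smul_refl u1 hUv vv tv with h0 | ⟨k, X, hX, hk⟩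
    · exact ⟨W, hW, by rw [h0]; simp⟩
    · obtain ⟨Q, hQ, h1, -⟩ := hX.exists_anticomm hX
      exact ⟨Q, hQ, by rw [hk, mul_smul_comm, smul_mul_assoc, h1, smul_neg]⟩
  exact .of_eq hA2 (isBal_mul_refl u1 u2 hQ hUv vv hQv) hQ.isBal
    (by rw [mul_assoc, hQ.sq, mul_one])

end Span

/-! ### Block operators and the equation expressing commutation with `Z`. -/

section Block

variable {n : Type*} [Fintype n] [DecidableEq n]

/-- One-qubit operators as block operators. -/
def scal : Matrix (Fin 2) (Fin 2) ℂ →+* Matrix (Fin 2) (Fin 2) (Matrix n n ℂ) :=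
  (algebraMap ℂ (Matrix n n ℂ)).mapMatrix

theorem scal_apply (u : Matrix (Fin 2) (Fin 2) ℂ) (i j : Fin 2) :
    (scal u : Matrix (Fin 2) (Fin 2) (Matrix n n ℂ)) i j = u i j • 1 := by
  simp [scal, Algebra.algebraMap_eq_smul_one]

/-- Block-diagonal operators. -/
def blk (A B : Matrix n n ℂ) : Matrix (Fin 2) (Fin 2) (Matrix n n ℂ) := Matrix.diagonal ![A, B]

theorem blk_mul_apply (A B : Matrix n n ℂ) (X : Matrix (Fin 2) (Fin 2) (Matrix n n ℂ))
    (i j : Fin 2) : (blk A B * X) i j = ![A, B] i * X i j := by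
  rw [blk, Matrix.diagonal_mul]

theorem mul_blk_apply (A B : Matrix n n ℂ) (X : Matrix (Fin 2) (Fin 2) (Matrix n n ℂ))
    (i j : Fin 2) : (X * blk A B) i j = X i j * ![A, B] j := by
  rw [blk, Matrix.mul_diagonal]

theorem blk_mul_blk (A B A' B' : Matrix n n ℂ) : blk A B * blk A' B' = blk (A * A') (B * B') := by
  refine Matrix.ext fun i j => ?_
  fin_cases i <;> fin_cases j <;> simp [blk_mul_apply] <;> simp [blk]

theorem blk_one : blk (1 : Matrix n n ℂ) 1 = 1 := by
  refine Matrix.ext fun i j => ?_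
  fin_cases i <;> fin_cases j <;> simp [blk]

theorem star_blk (A B : Matrix n n ℂ) : star (blk A B) = blk Aᴴ Bᴴ := by
  refine Matrix.ext fun i j => ?_
  fin_cases i <;> fin_cases j <;> simp [blk, Matrix.star_apply, Matrix.star_eq_conjTranspose]

theorem star_scal (u : Matrix (Fin 2) (Fin 2) ℂ) :
    star (scal u : Matrix (Fin 2) (Fin 2) (Matrix n n ℂ)) = scal uᴴ := by
  refine Matrix.ext fun i j => ?_
  simp [scal_apply, Matrix.star_apply]

theorem blk_injective {A B A' B' : Matrix n n ℂ} (h : blk A B = blk A' B') : A = A' ∧ B = B' :=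
  ⟨by simpa [blk] using congrFun (congrFun h 0) 0, by simpa [blk] using congrFun (congrFun h 1) 1⟩

theorem blk_self_scal (Q : Matrix n n ℂ) (u : Matrix (Fin 2) (Fin 2) ℂ) :
    blk Q Q * scal u = scal u * blk Q Q := by
  refine Matrix.ext fun i j => ?_
  rw [blk_mul_apply, mul_blk_apply, scal_apply]
  fin_cases i <;> fin_cases j <;> simp

theorem blk_scal_pauliZ (A B : Matrix n n ℂ) : blk A B * scal pauliZ = scal pauliZ * blk A B := by
  refine Matrix.ext fun i j => ?_
  rw [blk_mul_apply, mul_blk_apply, scal_apply]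
  fin_cases i <;> fin_cases j <;> simp [pauliZ]

theorem blk_one_neg (A B : Matrix n n ℂ) : blk A (-B) = scal pauliZ * blk A B := by
  refine Matrix.ext fun i j => ?_
  rw [mul_blk_apply, scal_apply]
  fin_cases i <;> fin_cases j <;> simp [pauliZ, blk]

theorem DiagOrAnti.blk_scal {u : Matrix (Fin 2) (Fin 2) ℂ} (h : DiagOrAnti u) :
    (∀ A B : Matrix n n ℂ, blk A B * scal u = scal u * blk A B) ∨
      ∀ A B : Matrix n n ℂ, blk A B * scal u = scal u * blk B A := by
  refine h.imp (fun h A B => ?_) (fun h A B => ?_) <;> obtain ⟨h1, h2⟩ := h <;>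
    refine Matrix.ext fun i j => ?_ <;> rw [blk_mul_apply, mul_blk_apply, scal_apply] <;>
    fin_cases i <;> fin_cases j <;> simp [h1, h2]

/-- A controlled `W` leaves the diagonal part alone and attaches a factor `W` to the off-diagonal
part. This is the origin of the axial and planar parts. -/
theorem conj_blk (W : Matrix n n ℂ) (hW : W * W = 1) (s : Matrix (Fin 2) (Fin 2) ℂ)
    (hs : s 1 1 = - s 0 0) : blk 1 W * scal s * blk 1 W
      = scal (s 0 0 • pauliZ) + scal (s - s 0 0 • pauliZ) * blk W W := by
  refine Matrix.ext fun i j => ?_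
  rw [mul_blk_apply, blk_mul_apply, Matrix.add_apply, mul_blk_apply, scal_apply, scal_apply,
    scal_apply]
  fin_cases i <;> fin_cases j <;> simp [pauliZ, hs, hW]

theorem conj_blk_axial {W : Matrix n n ℂ} (hW : W * W = 1) (u : Matrix (Fin 2) (Fin 2) ℂ)
    {v : Matrix (Fin 2) (Fin 2) ℂ} (hv : IsUni v) :
    scal u * (blk 1 W * scal (conjZ v) * blk 1 W) * scal uᴴ
      = scal (axial u v) + scal (planar u v) * blk W W := by
  rw [conj_blk W hW _ hv.conjZ_one_one, mul_add, add_mul, axial, planar]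
  congr 1
  · rw [← map_mul, ← map_mul, mul_smul_comm, smul_mul_assoc]
    rfl
  · rw [mul_assoc, mul_assoc, blk_self_scal, map_mul, map_mul]
    simp only [mul_assoc]

theorem IsUni.scal_mul {u : Matrix (Fin 2) (Fin 2) ℂ} (h : IsUni u) :
    (scal u : Matrix (Fin 2) (Fin 2) (Matrix n n ℂ)) * scal uᴴ = 1 ∧
    (scal uᴴ : Matrix (Fin 2) (Fin 2) (Matrix n n ℂ)) * scal u = 1 := by
  rw [← map_mul, ← map_mul, h.left, h.right, map_one]
  exact ⟨rfl, rfl⟩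

/-- The block operator of a circuit with three controlled gates. -/
def triple (W₁ W₂ W₃ : Matrix n n ℂ) (u₀ u₁ u₂ u₃ : Matrix (Fin 2) (Fin 2) ℂ) :
    Matrix (Fin 2) (Fin 2) (Matrix n n ℂ) :=
  scal u₀ * (blk 1 W₁ * (scal u₁ * (blk 1 W₂ * (scal u₂ * (blk 1 W₃ * scal u₃)))))

variable {W₁ W₂ W₃ A B : Matrix n n ℂ} {u₀ u₁ u₂ u₃ : Matrix (Fin 2) (Fin 2) ℂ}

theorem star_triple (h₁ : IsRefl W₁) (h₂ : IsRefl W₂) (h₃ : IsRefl W₃) :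
    star (triple W₁ W₂ W₃ u₀ u₁ u₂ u₃) = triple W₃ W₂ W₁ u₃ᴴ u₂ᴴ u₁ᴴ u₀ᴴ := by
  simp only [triple, star_mul, star_blk, star_scal, h₁.herm, h₂.herm, h₃.herm,
    Matrix.conjTranspose_one, mul_assoc]

theorem scal_mem_unitary (h : IsUni u₀) :
    (scal u₀ : Matrix (Fin 2) (Fin 2) (Matrix n n ℂ)) ∈ unitary _ := by
  rw [Unitary.mem_iff, star_scal]
  exact ⟨h.scal_mul.2, h.scal_mul.1⟩

theorem blk_mem_unitary_iff : blk A B ∈ unitary (Matrix (Fin 2) (Fin 2) (Matrix n n ℂ)) ↔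
    (Aᴴ * A = 1 ∧ A * Aᴴ = 1) ∧ Bᴴ * B = 1 ∧ B * Bᴴ = 1 := by
  rw [Unitary.mem_iff, star_blk, blk_mul_blk, blk_mul_blk, ← blk_one]
  constructor
  · rintro ⟨h1, h2⟩
    exact ⟨⟨(blk_injective h1).1, (blk_injective h2).1⟩, (blk_injective h1).2, (blk_injective h2).2⟩
  · rintro ⟨⟨h1, h2⟩, h3, h4⟩
    rw [h1, h2, h3, h4]
    exact ⟨rfl, rfl⟩

theorem IsRefl.blk_mem_unitary (h : IsRefl W₁) : blk 1 W₁ ∈ unitary _ :=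
  blk_mem_unitary_iff.2 ⟨by simp, h.isBal.left, h.isBal.right⟩

theorem unitary_of_triple (h₁ : IsRefl W₁) (h₂ : IsRefl W₂) (h₃ : IsRefl W₃) (k₀ : IsUni u₀)
    (k₁ : IsUni u₁) (k₂ : IsUni u₂) (k₃ : IsUni u₃) (h : triple W₁ W₂ W₃ u₀ u₁ u₂ u₃ = blk A B) :
    (Aᴴ * A = 1 ∧ A * Aᴴ = 1) ∧ Bᴴ * B = 1 ∧ B * Bᴴ = 1 := by
  rw [← blk_mem_unitary_iff, ← h]
  exact mul_mem (scal_mem_unitary k₀) (mul_mem h₁.blk_mem_unitary (mul_mem (scal_mem_unitary k₁)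
    (mul_mem h₂.blk_mem_unitary (mul_mem (scal_mem_unitary k₂) (mul_mem h₃.blk_mem_unitary
    (scal_mem_unitary k₃))))))

/-- In `Z * M = M * Z`, the outer gates are cancelled so that one side conjugates `Z` from the right
end of the circuit up to and through `W₂`, the other from the left end up to `u₁`. -/
theorem triple_equation (h₁ : IsRefl W₁) (h₂ : IsRefl W₂) (h₃ : IsRefl W₃) (k₀ : IsUni u₀)
    (k₁ : IsUni u₁) (k₂ : IsUni u₂) (k₃ : IsUni u₃) (h : triple W₁ W₂ W₃ u₀ u₁ u₂ u₃ = blk A B) :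
    blk 1 W₂ * (scal (axial u₂ u₃) + scal (planar u₂ u₃) * blk W₃ W₃) * blk 1 W₂
      = scal (axial u₁ᴴ u₀ᴴ) + scal (planar u₁ᴴ u₀ᴴ) * blk W₁ W₁ := by
  rw [← conj_blk_axial h₃.sq _ k₃, ← conj_blk_axial h₁.sq _ k₀.conjTranspose]
  have sq : ∀ {W : Matrix n n ℂ}, IsRefl W → ∀ X, blk 1 W * (blk 1 W * X) = X := fun hW X => by
    rw [← mul_assoc, blk_mul_blk, hW.sq, one_mul, blk_one, one_mul]
  have uu : ∀ {u : Matrix (Fin 2) (Fin 2) ℂ}, IsUni u →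
      ∀ X : Matrix (Fin 2) (Fin 2) (Matrix n n ℂ), scal u * (scal uᴴ * X) = X ∧
        scal uᴴ * (scal u * X) = X := fun hu X => by
    rw [← mul_assoc, ← mul_assoc, hu.scal_mul.1, hu.scal_mul.2, one_mul]
    exact ⟨rfl, rfl⟩
  have hZ : scal pauliZ * triple W₁ W₂ W₃ u₀ u₁ u₂ u₃
      = triple W₁ W₂ W₃ u₀ u₁ u₂ u₃ * scal pauliZ := by rw [h, blk_scal_pauliZ]
  have h1 := congrArg (fun X => scal u₁ᴴ * (blk 1 W₁ * (scal u₀ᴴ * (X * (scal u₃ᴴ *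
    (blk 1 W₃ * (scal u₂ᴴ * blk 1 W₂))))))) hZ
  simp only [triple, mul_assoc, (uu k₀ _).2, (uu k₁ _).2, (uu k₃ _).1, (uu k₂ _).1, sq h₁, sq h₃] at h1
  simp only [conjZ, map_mul, Matrix.conjTranspose_conjTranspose, mul_assoc]
  rw [← h1]
  have h2 : blk 1 W₂ * blk 1 W₂ = 1 := by rw [← mul_one (blk 1 W₂ * _), mul_assoc, sq h₂]
  rw [h2, mul_one]

end Block

/-! ### The special configurations in which two controlled gates suffice. -/

section Cases

variable {n : Type*} [Fintype n] [DecidableEq n]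

theorem inSpan_mul_apply {W W' : Matrix n n ℂ} {s : ℂ} (hW : W * W = 1) (hW' : W' * W' = 1)
    (hs : W * W' + W' * W = s • 1) {X Y : Matrix (Fin 2) (Fin 2) (Matrix n n ℂ)}
    (hX : ∀ i j, InSpan W W' (X i j)) (hY : ∀ i j, InSpan W W' (Y i j)) (i j : Fin 2) :
    InSpan W W' ((X * Y) i j) := by
  rw [Matrix.mul_apply, Fin.sum_univ_two]
  exact ((hX i 0).mul hW hW' hs (hY 0 j)).add ((hX i 1).mul hW hW' hs (hY 1 j))

theorem inSpan_scal_apply {W W' : Matrix n n ℂ} (u : Matrix (Fin 2) (Fin 2) ℂ) (i j : Fin 2) :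
    InSpan W W' (scal u i j) := by
  rw [scal_apply]
  exact inSpan_one.smul _

theorem inSpan_blk_apply {W W' A B : Matrix n n ℂ} (hA : InSpan W W' A) (hB : InSpan W W' B)
    (i j : Fin 2) : InSpan W W' (blk A B i j) := by
  fin_cases i <;> fin_cases j <;> simp [blk, hA, hB, inSpan_zero]

variable {W₁ W₂ W₃ A B : Matrix n n ℂ} {u₀ u₁ u₂ u₃ : Matrix (Fin 2) (Fin 2) ℂ}

theorem factors_of_triple_inSpan [Nonempty n] (h₁ : IsRefl W₁) (h₂ : IsRefl W₂) (h₃ : IsRefl W₃)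
    (k₀ : IsUni u₀) (k₁ : IsUni u₁) (k₂ : IsUni u₂) (k₃ : IsUni u₃)
    (h : triple W₁ W₂ W₃ u₀ u₁ u₂ u₃ = blk A B) {W W' : Matrix n n ℂ} {s : ℂ} (hW : IsRefl W)
    (hW' : IsRefl W') (hs : W * W' + W' * W = s • 1) (m₁ : InSpan W W' W₁) (m₂ : InSpan W W' W₂)
    (m₃ : InSpan W W' W₃) : Factors A B := by
  obtain ⟨⟨a1, a2⟩, b1, b2⟩ := unitary_of_triple h₁ h₂ h₃ k₀ k₁ k₂ k₃ h
  have mem : ∀ i j, InSpan W W' (blk A B i j) := by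
    rw [← h]
    have M := fun {X Y} => inSpan_mul_apply (X := X) (Y := Y) hW.sq hW'.sq hs
    exact M (inSpan_scal_apply _) (M (inSpan_blk_apply inSpan_one m₁) (M (inSpan_scal_apply _)
      (M (inSpan_blk_apply inSpan_one m₂) (M (inSpan_scal_apply _)
      (M (inSpan_blk_apply inSpan_one m₃) (inSpan_scal_apply _))))))
  exact factors_of_inSpan hW hW' hs a1 a2 b1 b2 (by simpa [blk] using mem 0 0)
    (by simpa [blk] using mem 1 1)

/-- As `u₃` is diagonal or anti-diagonal, the last controlled gate moves past it to the end, up to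
exchanging its blocks. What remains lives in the span of `1` and `W₁`. A reflection `Q`
anticommuting with `W₁` and `W₃` is inserted as `Q * Q` to make both factors balanced. -/
theorem factors_of_smul_left (h₁ : IsRefl W₁) (h₂ : IsRefl W₂) (h₃ : IsRefl W₃)
    (k₀ : IsUni u₀) (k₁ : IsUni u₁) (k₂ : IsUni u₂) (k₃ : IsUni u₃)
    (h : triple W₁ W₂ W₃ u₀ u₁ u₂ u₃ = blk A B) (hd : DiagOrAnti u₃) {k : ℂ}
    (hk : W₂ = k • W₁) : Factors A B := by
  obtain ⟨⟨a1, a2⟩, b1, b2⟩ := unitary_of_triple h₁ h₂ h₃ k₀ k₁ k₂ k₃ h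
  obtain ⟨N, hN⟩ : ∃ N : Matrix (Fin 2) (Fin 2) (Matrix n n ℂ),
    N = scal u₀ * (blk 1 W₁ * (scal u₁ * (blk 1 W₂ * (scal u₂ * scal u₃)))) := ⟨_, rfl⟩
  have hs : W₁ * W₁ + W₁ * W₁ = (2 : ℂ) • 1 := by rw [h₁.sq]; module
  have mem : ∀ i j, InSpan W₁ W₁ (N i j) := by
    rw [hN]
    have M := fun {X Y} => inSpan_mul_apply (X := X) (Y := Y) h₁.sq h₁.sq hs
    exact M (inSpan_scal_apply _) (M (inSpan_blk_apply inSpan_one inSpan_left)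
      (M (inSpan_scal_apply _) (M (inSpan_blk_apply inSpan_one (hk ▸ inSpan_left.smul k))
      (M (inSpan_scal_apply _) (inSpan_scal_apply _)))))
  obtain ⟨Q, hQ, q1, q3⟩ := h₁.exists_anticomm h₃
  have key : ∀ {A' B'}, N = blk A' B' → (A'ᴴ * A' = 1 ∧ A' * A'ᴴ = 1) → (B'ᴴ * B' = 1 ∧ B' * B'ᴴ = 1) →
      IsBal (A'ᴴ * B' * Q) ∧ IsBal (Q * (A'ᴴ * B')) := by
    intro A' B' e hA hB
    have mA : InSpan W₁ W₁ A' := by simpa [e, blk] using mem 0 0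
    have mB : InSpan W₁ W₁ B' := by simpa [e, blk] using mem 1 1
    obtain ⟨x, y, z, t, hU⟩ := (mA.conjTranspose h₁.herm h₁.herm hs).mul h₁.sq h₁.sq hs mB
    have hU' : A'ᴴ * B' = (x + t) • 1 + (y + z) • W₁ := by rw [hU, h₁.sq]; module
    have v1 := unitary_mul (A := A'ᴴ) (by simpa using hA.2) hB.1
    have v2 := mul_unitary (A := A'ᴴ) (by simpa using hA.1) hB.2
    have vv : ((y + z) • W₁) * ((y + z) • W₁) = ((y + z) * (y + z)) • 1 := by
      rw [smul_mul_smul_comm, h₁.sq]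
    have vq : Q * ((y + z) • W₁) = -((y + z) • W₁ * Q) := by
      rw [mul_smul_comm, smul_mul_assoc, q1, smul_neg]
    exact ⟨isBal_mul_refl v1 v2 hQ hU' vv vq, isBal_refl_mul v1 v2 hQ hU' vv vq⟩
  rcases hd.blk_scal (n := n) with hc | hc
  · have e : N * blk 1 W₃ = blk A B := by
      rw [← h, hN, triple, hc]
      simp only [mul_assoc]
    have e' : N = blk A (B * W₃) := by
      calc N = N * blk 1 W₃ * blk 1 W₃ := by
            rw [mul_assoc, blk_mul_blk, h₃.sq, mul_one, blk_one, mul_one]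
        _ = _ := by rw [e, blk_mul_blk, mul_one]
    obtain ⟨f, -⟩ := key e' ⟨a1, a2⟩ ⟨unitary_mul b1 h₃.isBal.left, mul_unitary b2 h₃.isBal.right⟩
    refine .of_eq a2 f (.mul_of_anticomm hQ h₃ q3) ?_
    calc Aᴴ * B = Aᴴ * B * (W₃ * (Q * Q) * W₃) := by rw [hQ.sq, mul_one, h₃.sq, mul_one]
      _ = _ := by simp only [mul_assoc]
  · have e : N * blk W₃ 1 = blk A B := by
      rw [← h, hN, triple, hc]
      simp only [mul_assoc]
    have e' : N = blk (A * W₃) B := by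
      calc N = N * blk W₃ 1 * blk W₃ 1 := by
            rw [mul_assoc, blk_mul_blk, h₃.sq, mul_one, blk_one, mul_one]
        _ = _ := by rw [e, blk_mul_blk, mul_one]
    obtain ⟨-, f⟩ := key e' ⟨unitary_mul a1 h₃.isBal.left, mul_unitary a2 h₃.isBal.right⟩ ⟨b1, b2⟩
    refine .of_eq a2 (.mul_of_anticomm h₃ hQ (by rw [q3, neg_neg])) f ?_
    rw [Matrix.conjTranspose_mul, h₃.herm]
    calc Aᴴ * B = W₃ * (Q * Q) * W₃ * Aᴴ * B := by
          rw [hQ.sq, mul_one, h₃.sq, one_mul]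
      _ = _ := by simp only [mul_assoc]

theorem factors_of_smul_right (h₁ : IsRefl W₁) (h₂ : IsRefl W₂) (h₃ : IsRefl W₃)
    (k₀ : IsUni u₀) (k₁ : IsUni u₁) (k₂ : IsUni u₂) (k₃ : IsUni u₃)
    (h : triple W₁ W₂ W₃ u₀ u₁ u₂ u₃ = blk A B) (hd : DiagOrAnti u₀) {k : ℂ}
    (hk : W₂ = k • W₃) : Factors A B := by
  obtain ⟨⟨a1, a2⟩, -⟩ := unitary_of_triple h₁ h₂ h₃ k₀ k₁ k₂ k₃ h
  refine .of_conjTranspose a1 a2 (factors_of_smul_left h₃ h₂ h₁ k₃.conjTranspose k₂.conjTranspose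
    k₁.conjTranspose k₀.conjTranspose ?_ hd.conjTranspose hk)
  rw [← star_triple h₁ h₂ h₃, h, star_blk]

/-- Passing `Q` through a controlled `W` leaves a `Z` on the control qubit. -/
theorem blk_anticomm {Q W : Matrix n n ℂ} (h : Q * W = -(W * Q))
    (X : Matrix (Fin 2) (Fin 2) (Matrix n n ℂ)) :
    blk Q Q * (blk 1 W * X) = scal pauliZ * (blk 1 W * (blk Q Q * X)) := by
  have : blk Q Q * blk 1 W = scal pauliZ * (blk 1 W * blk Q Q) := by
    rw [blk_mul_blk, h, blk_mul_blk, ← blk_one_neg, mul_one, one_mul]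
  rw [← mul_assoc, this]
  simp only [mul_assoc]

theorem scal_conjZ (k₀ : IsUni u₀) (X : Matrix (Fin 2) (Fin 2) (Matrix n n ℂ)) :
    scal u₀ * (scal pauliZ * X) = scal (conjZ u₀) * (scal u₀ * X) := by
  rw [← mul_assoc, ← mul_assoc, ← map_mul, ← map_mul, conjZ, mul_assoc (u₀ * pauliZ), k₀.left,
    mul_one]

theorem IsUni.pauliZ_mul (k₃ : IsUni u₃) : pauliZ * u₃ = u₃ * conjZ u₃ᴴ := by
  rw [conjZ, Matrix.conjTranspose_conjTranspose, ← mul_assoc, ← mul_assoc, k₃.right, one_mul]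

theorem offDiag_blk_apply {H K : Matrix (Fin 2) (Fin 2) ℂ} (hH : H 0 0 = 0) (E : Matrix n n ℂ) :
    (scal H * blk A B * scal K * blk E E : Matrix (Fin 2) (Fin 2) (Matrix n n ℂ)) 0 0 = (H 0 1 * K 1 0) • (B * E) := by
  rw [mul_blk_apply, Matrix.mul_apply, Fin.sum_univ_two, mul_blk_apply, mul_blk_apply]
  simp [scal_apply, hH, smul_smul, mul_comm]

theorem scal_smul (b : ℂ) (u : Matrix (Fin 2) (Fin 2) ℂ) :
    (scal (b • u) : Matrix (Fin 2) (Fin 2) (Matrix n n ℂ)) = b • scal u := by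
  refine Matrix.ext fun i j => ?_
  rw [Matrix.smul_apply, scal_apply, scal_apply, Matrix.smul_apply, smul_smul, smul_eq_mul]

theorem Factors.of_mul_eq_smul [Nonempty n] {Q E G : Matrix n n ℂ} {k : ℂ} (a1 : Aᴴ * A = 1)
    (a2 : A * Aᴴ = 1) (b1 : Bᴴ * B = 1) (b2 : B * Bᴴ = 1) (hQ : IsRefl Q) (hG : IsBal G)
    (hE : E * G = 1) (h : Q * A = k • (B * E)) : Factors A B := by
  have hk : k ≠ 0 := by
    rintro rfl
    have h0 : (1 : Matrix n n ℂ) = Aᴴ * (Q * (Q * A)) := by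
      rw [← mul_assoc Q, hQ.sq, one_mul, a1]
    rw [h, zero_smul, mul_zero, mul_zero] at h0
    exact one_ne_zero h0
  refine .of_eq_smul (k := k⁻¹) a1 a2 b1 b2 (hQ.isBal.conj a1 a2) hG ?_
  calc B = k⁻¹ • (k • (B * E)) * G := by
        rw [inv_smul_smul₀ hk, mul_assoc, hE, mul_one]
    _ = k⁻¹ • (A * Aᴴ * Q * A * G) := by rw [← h, a2, one_mul, smul_mul_assoc]
    _ = _ := by simp only [mul_assoc]

/-- Take `Q` anticommuting with `W₁` and `W₃`, hence commuting with `W₂`. Moving `Q` through the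
circuit leaves two `Z`s, which go out at the two ends as `conjZ u₀` and `conjZ u₃ᴴ`. The former is
off-diagonal, so the upper left block reads `Q * A ∝ B * Q`. -/
theorem factors_of_equatorial [Nonempty n] (h₁ : IsRefl W₁) (h₂ : IsRefl W₂) (h₃ : IsRefl W₃)
    (k₀ : IsUni u₀) (k₁ : IsUni u₁) (k₂ : IsUni u₂) (k₃ : IsUni u₃)
    (h : triple W₁ W₂ W₃ u₀ u₁ u₂ u₃ = blk A B) (z₀ : conjZ u₀ 0 0 = 0) {k : ℂ}
    (hk : W₂ = k • (W₃ * W₁)) : Factors A B := by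
  obtain ⟨⟨a1, a2⟩, b1, b2⟩ := unitary_of_triple h₁ h₂ h₃ k₀ k₁ k₂ k₃ h
  obtain ⟨Q, hQ, q1, q3⟩ := h₁.exists_anticomm h₃
  have q2 : Q * W₂ = W₂ * Q := by
    rw [hk, mul_smul_comm, smul_mul_assoc, ← mul_assoc, q3, neg_mul, mul_assoc, q1, mul_neg,
      neg_neg, mul_assoc]
  have e2 : ∀ X, blk Q Q * (blk 1 W₂ * X) = blk 1 W₂ * (blk Q Q * X) := fun X => by
    rw [← mul_assoc, ← mul_assoc, blk_mul_blk, blk_mul_blk, q2, mul_one, one_mul]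
  have es : ∀ (u : Matrix (Fin 2) (Fin 2) ℂ) (X : Matrix (Fin 2) (Fin 2) (Matrix n n ℂ)),
      blk Q Q * (scal u * X) = scal u * (blk Q Q * X) := fun u X => by
    rw [← mul_assoc, ← mul_assoc, blk_self_scal]
  have ez : ∀ X : Matrix (Fin 2) (Fin 2) (Matrix n n ℂ), scal pauliZ * (blk 1 W₃ * X)
      = blk 1 W₃ * (scal pauliZ * X) := fun X => by
    rw [← mul_assoc, ← mul_assoc, blk_scal_pauliZ]
  have e3 : ∀ X : Matrix (Fin 2) (Fin 2) (Matrix n n ℂ), scal pauliZ * (scal u₃ * X)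
      = scal u₃ * (scal (conjZ u₃ᴴ) * X) := fun X => by
    rw [← mul_assoc, ← mul_assoc, ← map_mul, ← map_mul, k₃.pauliZ_mul]
  have key : blk Q Q * blk A B = scal (conjZ u₀) * blk A B * scal (conjZ u₃ᴴ) * blk Q Q := by
    rw [← h]
    simp only [triple, mul_assoc, es, blk_anticomm q1, e2, blk_anticomm q3, ez, e3,
      scal_conjZ k₀, blk_self_scal]
  have := congrFun (congrFun key 0) 0
  rw [offDiag_blk_apply z₀, blk_mul_blk] at this
  exact .of_mul_eq_smul a1 a2 b1 b2 hQ hQ.isBal hQ.sq (by simpa [blk] using this)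

/-- Here `Q` anticommutes with all three reflections. The `Z` left at `W₂` moves right: `u₂` turns
it into a multiple of the off-diagonal `conjZ u₃`, which picks up a factor `W₃` at the last
controlled gate. The upper left block then reads `Q * A ∝ B * (W₃ * Q)`. -/
theorem factors_of_polar [Nonempty n] (h₁ : IsRefl W₁) (h₂ : IsRefl W₂) (h₃ : IsRefl W₃)
    (k₀ : IsUni u₀) (k₁ : IsUni u₁) (k₂ : IsUni u₂) (k₃ : IsUni u₃)
    (h : triple W₁ W₂ W₃ u₀ u₁ u₂ u₃ = blk A B) (z₀ : conjZ u₀ 0 0 = 0) (z₃ : conjZ u₃ 0 0 = 0)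
    {k b : ℂ} (hk : W₃ = k • W₁) (hb : conjZ (u₂ * u₃) = b • pauliZ) : Factors A B := by
  obtain ⟨⟨a1, a2⟩, b1, b2⟩ := unitary_of_triple h₁ h₂ h₃ k₀ k₁ k₂ k₃ h
  obtain ⟨Q, hQ, q1, q2⟩ := h₁.exists_anticomm h₂
  have q3 : Q * W₃ = -(W₃ * Q) := by rw [hk, mul_smul_comm, smul_mul_assoc, q1, smul_neg]
  have hbb : b * b = 1 := by
    have h0 := (k₂.mul k₃).conjZ_sq
    rw [hb, smul_mul_smul_comm, pauliZ_sq] at h0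
    simpa using congrFun (congrFun h0 0) 0
  have hZu : pauliZ * u₂ = b • (u₂ * conjZ u₃) := by
    have h0 : conjZ (u₂ * u₃) = u₂ * conjZ u₃ * u₂ᴴ := by
      simp [conjZ, Matrix.conjTranspose_mul, mul_assoc]
    rw [h0] at hb
    calc pauliZ * u₂ = b • ((b • pauliZ) * u₂) := by
          rw [smul_mul_assoc, smul_smul, hbb, one_smul]
      _ = _ := by rw [← hb, mul_assoc _ u₂ᴴ, k₂.left, mul_one]
  have es : ∀ (E : Matrix n n ℂ) (u : Matrix (Fin 2) (Fin 2) ℂ)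
      (X : Matrix (Fin 2) (Fin 2) (Matrix n n ℂ)),
      blk E E * (scal u * X) = scal u * (blk E E * X) := fun E u X => by
    rw [← mul_assoc, ← mul_assoc, blk_self_scal]
  have ez : ∀ (W : Matrix n n ℂ) (X : Matrix (Fin 2) (Fin 2) (Matrix n n ℂ)),
      scal pauliZ * (blk 1 W * X) = blk 1 W * (scal pauliZ * X) := fun W X => by
    rw [← mul_assoc, ← mul_assoc, blk_scal_pauliZ]
  have e2 : ∀ X : Matrix (Fin 2) (Fin 2) (Matrix n n ℂ), scal pauliZ * (scal u₂ * X)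
      = b • (scal u₂ * (scal (conjZ u₃) * X)) := fun X => by
    rw [← mul_assoc, ← mul_assoc, ← map_mul, ← map_mul, hZu, scal_smul, smul_mul_assoc]
  have ec : ∀ X : Matrix (Fin 2) (Fin 2) (Matrix n n ℂ), scal (conjZ u₃) * (blk 1 W₃ * X)
      = blk 1 W₃ * (scal (conjZ u₃) * (blk W₃ W₃ * X)) := fun X => by
    have z1 : conjZ u₃ 1 1 = 0 := by rw [k₃.conjZ_one_one, z₃, neg_zero]
    have : scal (conjZ u₃) * blk 1 W₃ = blk 1 W₃ * (scal (conjZ u₃) * blk W₃ W₃) := by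
      refine Matrix.ext fun i j => ?_
      rw [mul_blk_apply, blk_mul_apply, mul_blk_apply, scal_apply]
      fin_cases i <;> fin_cases j <;> simp [z₃, z1, h₃.sq]
    rw [← mul_assoc, this]
    simp only [mul_assoc]
  have e3 : ∀ X : Matrix (Fin 2) (Fin 2) (Matrix n n ℂ),
      scal (conjZ u₃) * (scal pauliZ * (scal u₃ * X))
      = scal u₃ * (scal (pauliZ * conjZ u₃ᴴ) * X) := fun X => by
    rw [← mul_assoc (scal pauliZ), ← map_mul, ← mul_assoc, ← map_mul, ← mul_assoc (scal u₃),
      ← map_mul, k₃.pauliZ_mul]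
    congr 2
    rw [conjZ, ← mul_assoc, mul_assoc (u₃ * pauliZ), k₃.left, mul_one, mul_assoc]
  have key : blk Q Q * blk A B = b • (scal (conjZ u₀) * blk A B * scal (pauliZ * conjZ u₃ᴴ)
      * blk (W₃ * Q) (W₃ * Q)) := by
    rw [← h, ← blk_mul_blk]
    simp only [triple, mul_assoc, es, blk_anticomm q1, blk_anticomm q2, blk_anticomm q3, ez W₂,
      ez W₃, e2, e3, ec, scal_conjZ k₀, mul_smul_comm, blk_self_scal]
  have := congrFun (congrFun key 0) 0
  rw [Matrix.smul_apply, offDiag_blk_apply z₀, blk_mul_blk, smul_smul] at this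
  exact .of_mul_eq_smul (E := W₃ * Q) (G := Q * W₃) a1 a2 b1 b2 hQ (.mul_of_anticomm hQ h₃ q3)
    (by rw [mul_assoc, ← mul_assoc Q, hQ.sq, one_mul, h₃.sq]) (by simpa [blk] using this)

/-- The inner gates can be moved past the controlled ones, which collapse to a single `blk X Y`.
Since the product of the three commuting reflections is scalar, `Y` is a multiple of `X` in all four
cases, so `B` is a multiple of `A`. -/
theorem factors_of_diagOrAnti [Nonempty n] (h₁ : IsRefl W₁) (h₂ : IsRefl W₂) (h₃ : IsRefl W₃)
    (k₀ : IsUni u₀) (k₁ : IsUni u₁) (k₂ : IsUni u₂) (k₃ : IsUni u₃)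
    (h : triple W₁ W₂ W₃ u₀ u₁ u₂ u₃ = blk A B) (d₁ : DiagOrAnti u₁) (d₂ : DiagOrAnti u₂)
    (hc : W₁ * W₃ = W₃ * W₁) {k : ℂ} (hk : W₂ = k • (W₃ * W₁)) : Factors A B := by
  obtain ⟨⟨a1, a2⟩, b1, b2⟩ := unitary_of_triple h₁ h₂ h₃ k₀ k₁ k₂ k₃ h
  have w1 : W₁ * W₂ = k • W₃ := by rw [hk, mul_smul_comm, ← hc, ← mul_assoc, h₁.sq, one_mul]
  have w2 : W₂ * W₃ = k • W₁ := by rw [hk, smul_mul_assoc, ← hc, mul_assoc, h₃.sq, mul_one]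
  have kk : k * k = 1 := by
    have h0 := h₂.sq
    nth_rw 2 [hk] at h0
    rw [mul_smul_comm, ← mul_assoc, w2, smul_mul_assoc, h₁.sq, smul_smul] at h0
    obtain ⟨i⟩ := ‹Nonempty n›
    simpa using congrFun (congrFun h0 i) i
  have hA : ∃ (m : Matrix (Fin 2) (Fin 2) ℂ) (X : Matrix n n ℂ), blk A B = scal m * blk X X := by
    have fin : ∀ X Y : Matrix n n ℂ, Y = k • X →
        ∃ D : Matrix (Fin 2) (Fin 2) ℂ, blk X Y = scal D * blk X X := fun X Y e => by
      refine ⟨!![1, 0; 0, k], Matrix.ext fun i j => ?_⟩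
      rw [mul_blk_apply, scal_apply]
      fin_cases i <;> fin_cases j <;> simp [blk, e]
    have fin' : ∀ {X Y : Matrix n n ℂ} {u v : Matrix (Fin 2) (Fin 2) ℂ}, Y = k • X →
        triple W₁ W₂ W₃ u₀ u₁ u₂ u₃ = scal u * (blk X Y * scal v) →
        ∃ (m : Matrix (Fin 2) (Fin 2) ℂ) (X : Matrix n n ℂ), blk A B = scal m * blk X X := by
      intro X Y u v e e'
      obtain ⟨D, hD⟩ := fin X Y e
      refine ⟨u * (D * v), X, ?_⟩
      rw [← h, e', hD, mul_assoc, blk_self_scal, ← mul_assoc, ← mul_assoc, ← map_mul, ← map_mul,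
        mul_assoc]
    have e : triple W₁ W₂ W₃ u₀ u₁ u₂ u₃ = scal u₀ * ((blk 1 W₁ * scal u₁) *
        ((blk 1 W₂ * scal u₂) * blk 1 W₃)) * scal u₃ := by
      simp only [triple, mul_assoc]
    rcases d₁.blk_scal (n := n) with c1 | c1 <;> rcases d₂.blk_scal (n := n) with c2 | c2
    · refine fin' (X := 1) (Y := W₁ * (W₂ * W₃)) (u := u₀ * (u₁ * u₂)) (v := u₃)
        (by rw [w2, mul_smul_comm, h₁.sq]) ?_
      rw [e, c1, c2]
      simp only [mul_assoc, map_mul]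
      rw [← mul_assoc (blk 1 W₁), c2, mul_assoc, ← mul_assoc (blk 1 W₂), blk_mul_blk,
        ← mul_assoc (blk 1 W₁), blk_mul_blk]
      simp
    · refine fin' (X := W₁ * W₂) (Y := W₃) (u := u₀ * (u₁ * u₂)) (v := u₃)
        (by rw [w1, smul_smul, kk, one_smul]) ?_
      rw [e, c1, c2]
      simp only [mul_assoc, map_mul]
      rw [← mul_assoc (blk 1 W₁), c2, mul_assoc, ← mul_assoc (blk W₂ 1), blk_mul_blk,
        ← mul_assoc (blk W₁ 1), blk_mul_blk]
      simp
    · refine fin' (X := W₁) (Y := W₂ * W₃) (u := u₀ * (u₁ * u₂)) (v := u₃) w2 ?_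
      rw [e, c1, c2]
      simp only [mul_assoc, map_mul]
      rw [← mul_assoc (blk W₁ 1), c2, mul_assoc, ← mul_assoc (blk 1 W₂), blk_mul_blk,
        ← mul_assoc (blk W₁ 1), blk_mul_blk]
      simp
    · refine fin' (X := W₂) (Y := W₁ * W₃) (u := u₀ * (u₁ * u₂)) (v := u₃)
        (by rw [hk, smul_smul, kk, one_smul, hc]) ?_
      rw [e, c1, c2]
      simp only [mul_assoc, map_mul]
      rw [← mul_assoc (blk W₁ 1), c2, mul_assoc, ← mul_assoc (blk W₂ 1), blk_mul_blk,
        ← mul_assoc (blk 1 W₁), blk_mul_blk]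
      simp
  obtain ⟨m, X, hX⟩ := hA
  have hA : A = m 0 0 • X := by
    have := congrFun (congrFun hX 0) 0
    rw [mul_blk_apply, scal_apply] at this
    simpa [blk] using this
  have hB : B = m 1 1 • X := by
    have := congrFun (congrFun hX 1) 1
    rw [mul_blk_apply, scal_apply] at this
    simpa [blk] using this
  have m0 : m 0 0 ≠ 0 := fun h0 => by
    rw [hA, h0, zero_smul, mul_zero] at a1
    exact zero_ne_one a1
  refine .of_eq_smul (k := m 1 1 / m 0 0) a1 a2 b1 b2 h₁.isBal h₁.isBal ?_
  rw [mul_assoc, h₁.sq, mul_one, hA, hB, smul_smul, div_mul_cancel₀ _ m0]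

end Cases

/-! ### The dichotomy for block-diagonal triples. -/

section Core

variable {n : Type*} [Fintype n] [DecidableEq n]

theorem IsRefl.coeffs_eq [Nonempty n] {W W' : Matrix n n ℂ} (h : IsRefl W) (h' : IsRefl W')
    {a b c d : ℂ} (e : a • 1 + b • W = c • 1 + d • W') : a = c ∧ b • W = d • W' := by
  have h1 := congrArg Matrix.trace e
  simp only [Matrix.trace_add, Matrix.trace_smul, h.tr, h'.tr,
    Matrix.trace_one, smul_eq_mul] at h1
  have h2 : a = c := mul_right_cancel₀ (b := (Fintype.card n : ℂ)) (by simp) (by simpa using h1)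
  refine ⟨h2, ?_⟩
  rw [h2] at e
  exact add_left_cancel e

/-- A reflection which agrees with `η` on an eigenspace of `W` is a multiple of `W`. -/
theorem IsRefl.eq_smul_of_eigenspace [Nonempty n] {W Y : Matrix n n ℂ} (hW : IsRefl W)
    (hY : IsRefl Y) (hc : W * Y = Y * W) {δ η : ℂ} (hδ : δ * δ = 1) (hδ' : star δ = δ)
    (h : (1 + δ • W) * Y = η • (1 + δ • W)) : ∃ k : ℂ, Y = k • W := by
  obtain ⟨i⟩ := ‹Nonempty n›
  have hd : (Fintype.card n : ℂ) ≠ 0 := by simp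
  have tr : (1 + δ • W).trace = Fintype.card n := by
    rw [Matrix.trace_add, Matrix.trace_smul, hW.tr, smul_zero, add_zero, Matrix.trace_one]
  have hη : η * η = 1 := by
    have h1 : (1 + δ • W) = (η * η) • (1 + δ • W) := by
      calc (1 + δ • W) = (1 + δ • W) * Y * Y := by rw [mul_assoc, hY.sq, mul_one]
        _ = _ := by rw [h, smul_mul_assoc, h, smul_smul]
    have h2 := congrArg Matrix.trace h1
    rw [Matrix.trace_smul, tr, smul_eq_mul] at h2
    exact mul_right_cancel₀ hd (by rw [one_mul, ← h2])
  have hη' : star η = η := by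
    rcases mul_self_eq_one_iff.1 hη with e | e <;> simp [e]
  have hWY : δ • (W * Y) = η • 1 + (η * δ) • W - Y := by
    rw [add_mul, one_mul, smul_mul_assoc] at h
    rw [eq_sub_iff_add_eq, add_comm, h]
    module
  -- Four times the projection onto the vectors of the other eigenspace of `W` on which `Y` is still
  -- `η`. By `hWY` it is a combination of `W` and `Y`, hence traceless, hence zero.
  obtain ⟨G, hG⟩ : ∃ G, G = (1 - δ • W) * (1 + η • Y) := ⟨_, rfl⟩
  have cG : (1 + η • Y) * (1 - δ • W) = G := by
    rw [hG]
    simp only [mul_add, add_mul, mul_sub, sub_mul, smul_mul_assoc, mul_smul_comm, hc, one_mul,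
      mul_one]
    module
  have GH : Gᴴ = G := by
    rw [← cG, Matrix.conjTranspose_mul, Matrix.conjTranspose_add, Matrix.conjTranspose_sub,
      Matrix.conjTranspose_smul, Matrix.conjTranspose_smul, hW.herm, hY.herm, hδ', hη',
      Matrix.conjTranspose_one, cG, hG]
  have GG : G * G = (4 : ℂ) • G := by
    have s1 : (1 - δ • W) * (1 - δ • W) = (2 : ℂ) • (1 - δ • W) := by
      have : (1 - δ • W) * (1 - δ • W) = (1 + δ * δ) • 1 - (2 * δ) • W := by
        simp only [mul_sub, sub_mul, smul_mul_assoc, mul_smul_comm, hW.sq, one_mul, mul_one]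
        module
      rw [this, hδ]
      module
    have s2 : (1 + η • Y) * (1 + η • Y) = (2 : ℂ) • (1 + η • Y) := by
      have : (1 + η • Y) * (1 + η • Y) = (1 + η * η) • 1 + (2 * η) • Y := by
        simp only [mul_add, add_mul, smul_mul_assoc, mul_smul_comm, hY.sq, one_mul, mul_one]
        module
      rw [this, hη]
      module
    calc G * G = (1 - δ • W) * ((1 + η • Y) * (1 - δ • W)) * (1 + η • Y) := by
          rw [hG]; simp only [mul_assoc]
      _ = ((1 - δ • W) * (1 - δ • W)) * ((1 + η • Y) * (1 + η • Y)) := by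
          rw [cG, hG]; simp only [mul_assoc]
      _ = _ := by rw [s1, s2, smul_mul_smul_comm, ← hG]; norm_num
  have Gx : G = (-(2 * δ)) • W + (2 * η) • Y := by
    have : G = 1 + η • Y - δ • W - η • (δ • (W * Y)) := by
      rw [hG]
      simp only [mul_add, sub_mul, smul_mul_assoc, mul_smul_comm, one_mul, mul_one]
      module
    rw [this, hWY, smul_sub, smul_add, smul_smul, smul_smul, ← mul_assoc, hη]
    module
  have G0 : G = 0 := by
    rw [← Matrix.trace_conjTranspose_mul_self_eq_zero_iff, GH, GG, Gx, Matrix.trace_smul,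
      Matrix.trace_add, Matrix.trace_smul, Matrix.trace_smul, hW.tr, hY.tr]
    simp
  refine ⟨η * δ, ?_⟩
  rw [G0] at Gx
  calc Y = (η * η) • Y := by rw [hη, one_smul]
    _ = (η / 2) • ((-(2 * δ)) • W + (2 * η) • Y) + (η * δ) • W := by module
    _ = _ := by rw [← Gx, smul_zero, zero_add]

variable {W₁ W₂ W₃ A B : Matrix n n ℂ} {u₀ u₁ u₂ u₃ : Matrix (Fin 2) (Fin 2) ℂ}

/-- The upper left block separates into two relations by taking traces; the lower right block, the
same relation conjugated by `W₂`, yields the commutation; the upper right block is the last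
relation. -/
theorem triple_entries [Nonempty n] (h₁ : IsRefl W₁) (h₂ : IsRefl W₂) (h₃ : IsRefl W₃)
    (k₀ : IsUni u₀) (k₁ : IsUni u₁) (k₂ : IsUni u₂) (k₃ : IsUni u₃)
    (h : triple W₁ W₂ W₃ u₀ u₁ u₂ u₃ = blk A B) :
    axial u₂ u₃ 0 0 = axial u₁ᴴ u₀ᴴ 0 0 ∧
    planar u₂ u₃ 0 0 • W₃ = planar u₁ᴴ u₀ᴴ 0 0 • W₁ ∧
    planar u₂ u₃ 0 0 • (W₃ * W₂) = planar u₂ u₃ 0 0 • (W₂ * W₃) ∧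
    (axial u₂ u₃ 0 1 • 1 + planar u₂ u₃ 0 1 • W₃) * W₂
      = axial u₁ᴴ u₀ᴴ 0 1 • 1 + planar u₁ᴴ u₀ᴴ 0 1 • W₁ := by
  have eq := triple_equation h₁ h₂ h₃ k₀ k₁ k₂ k₃ h
  have e : ∀ i j, ![1, W₂] i * (axial u₂ u₃ i j • 1 + planar u₂ u₃ i j • W₃) * ![1, W₂] j
      = axial u₁ᴴ u₀ᴴ i j • 1 + planar u₁ᴴ u₀ᴴ i j • W₁ := fun i j => by
    have h1 := congrFun (congrFun eq i) j
    rw [mul_blk_apply, blk_mul_apply, Matrix.add_apply, Matrix.add_apply, mul_blk_apply,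
      mul_blk_apply, scal_apply, scal_apply, scal_apply, scal_apply] at h1
    have h2 : ∀ W : Matrix n n ℂ, ![W, W] j = W := fun W => by fin_cases j <;> rfl
    simpa only [h2, smul_mul_assoc, one_mul] using h1
  have e00 := e 0 0
  have e01 := e 0 1
  have e11 := e 1 1
  simp only [Matrix.cons_val_zero, Matrix.cons_val_one, one_mul, mul_one] at e00 e01 e11
  obtain ⟨f1, f2⟩ := h₃.coeffs_eq h₁ e00
  refine ⟨f1, f2, ?_, e01⟩
  rw [k₂.axial_one_one, k₁.conjTranspose.axial_one_one, k₂.planar_one_one k₃,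
    k₁.conjTranspose.planar_one_one k₀.conjTranspose, f1, mul_add, add_mul, mul_smul_comm,
    smul_mul_assoc, mul_one, h₂.sq, neg_smul (planar u₁ᴴ u₀ᴴ 0 0), ← f2] at e11
  have e2 := add_left_cancel e11
  rw [mul_smul_comm, smul_mul_assoc, neg_smul, neg_inj] at e2
  rw [← smul_mul_assoc, ← e2, smul_mul_assoc]
  simp only [mul_assoc, h₂.sq, mul_one]

theorem IsRefl.ne_zero [Nonempty n] {W : Matrix n n ℂ} (h : IsRefl W) : W ≠ 0 := fun h0 => by
  have := h.sq
  rw [h0, mul_zero] at this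
  exact zero_ne_one this

theorem factors_of_planar_ne_zero [Nonempty n] (h₁ : IsRefl W₁) (h₂ : IsRefl W₂) (h₃ : IsRefl W₃)
    (k₀ : IsUni u₀) (k₁ : IsUni u₁) (k₂ : IsUni u₂) (k₃ : IsUni u₃)
    (h : triple W₁ W₂ W₃ u₀ u₁ u₂ u₃ = blk A B) (hb : planar u₂ u₃ 0 0 ≠ 0) : Factors A B := by
  obtain ⟨E1, E2, E3, E4⟩ := triple_entries h₁ h₂ h₃ k₀ k₁ k₂ k₃ h
  have P := k₂.axial_planar k₃
  have hcomm : W₃ * W₂ = W₂ * W₃ := smul_right_injective _ hb E3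
  have hW3 : W₃ = ((planar u₂ u₃ 0 0)⁻¹ * planar u₁ᴴ u₀ᴴ 0 0) • W₁ := by
    rw [mul_smul, ← E2, inv_smul_smul₀ hb]
  set κ := (planar u₂ u₃ 0 0)⁻¹ * planar u₁ᴴ u₀ᴴ 0 0 with hκ
  have hκ0 : κ ≠ 0 := fun h0 => h₃.ne_zero (by rw [hW3, h0, zero_smul])
  have hW1 : W₁ = κ⁻¹ • W₃ := by rw [hW3, inv_smul_smul₀ hκ0]
  have hs : W₃ * W₃ + W₃ * W₃ = (2 : ℂ) • 1 := by rw [h₃.sq]; module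
  have span : InSpan W₃ W₃ W₂ → Factors A B := fun m₂ =>
    factors_of_triple_inSpan h₁ h₂ h₃ k₀ k₁ k₂ k₃ h h₃ h₃ hs
      (by rw [hW1]; exact inSpan_left.smul _) m₂ inSpan_left
  have E4' : (axial u₂ u₃ 0 1 • 1 + planar u₂ u₃ 0 1 • W₃) * W₂
      = axial u₁ᴴ u₀ᴴ 0 1 • 1 + (planar u₁ᴴ u₀ᴴ 0 1 * κ⁻¹) • W₃ := by
    rw [E4, mul_smul, ← hW1]
  generalize hp : axial u₂ u₃ 0 1 = p at E4' P
  generalize hq : planar u₂ u₃ 0 1 = q at E4' P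
  generalize hc : axial u₁ᴴ u₀ᴴ 0 1 = c at E4'
  generalize planar u₁ᴴ u₀ᴴ 0 1 * κ⁻¹ = d at E4'
  -- Whether `p + q * W₃` is invertible, since `(p - q W₃)(p + q W₃) = p² - q²`. If it is, `W₂` lies
  -- in the span of `1` and `W₃`. If not, either `p = q = 0`, the polar case, or it is a multiple of
  -- a spectral projection of `W₃`, on whose range `W₂` is scalar.
  by_cases hpq : p * p = q * q
  · by_cases p0 : p = 0
    · have q0 : q = 0 := by simpa [p0] using hpq.symm
      subst p0 q0
      have E5 : (0 : ℂ) • 1 + (0 : ℂ) • W₃ = c • 1 + d • W₃ := by rw [← E4']; simp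
      have c0 := (h₃.coeffs_eq h₃ E5).1
      have a0 : axial u₂ u₃ 0 0 = 0 := by simpa [hb] using P
      have z₃ := k₂.conjZ_eq_zero_of_axial a0 hp
      have z₀ := k₁.conjTranspose.conjZ_eq_zero_of_axial (E1 ▸ a0) (hc.trans c0.symm)
      rw [k₀.conjZ_conjTranspose] at z₀
      refine factors_of_polar h₁ h₂ h₃ k₀ k₁ k₂ k₃ h z₀ z₃ hW3 (b := planar u₂ u₃ 0 0) ?_
      have pz : planar u₂ u₃ 1 0 = 0 := by
        rw [← planar_herm, Matrix.conjTranspose_apply, hq, star_zero]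
      rw [← axial_add_planar, eq_zero_of_herm (axial_herm u₂ u₃) (k₂.axial_one_one _) a0 hp,
        zero_add]
      refine Matrix.ext fun i j => ?_
      fin_cases i <;> fin_cases j <;> simp [pauliZ, hq, pz, k₂.planar_one_one k₃]
    · obtain ⟨δ, hδ⟩ : ∃ δ, q = δ * p := ⟨q / p, by field_simp⟩
      have δδ : δ * δ = 1 := by
        rw [hδ] at hpq
        have : (δ * δ - 1) * (p * p) = 0 := by linear_combination -hpq
        have := (mul_eq_zero.1 this).resolve_right (mul_ne_zero p0 p0)
        linear_combination this
      have hδ' : star δ = δ := by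
        rcases mul_self_eq_one_iff.1 δδ with e | e <;> simp [e]
      have E5 : p • ((1 + δ • W₃) * W₂) = c • 1 + d • W₃ := by
        rw [← E4', hδ, ← smul_mul_assoc]
        congr 1
        module
      -- Multiplying by `1 - δ W₃` kills the left side of `E5`.
      have E6 : (c - δ * d) • 1 + (d - δ * c) • W₃ = (0 : ℂ) • 1 + (0 : ℂ) • W₃ := by
        have e1 : (1 - δ • W₃) * (c • 1 + d • W₃) = (c - δ * d) • 1 + (d - δ * c) • W₃ := by
          simp only [mul_add, sub_mul, smul_mul_assoc, mul_smul_comm, h₃.sq, one_mul, mul_one]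
          module
        have e2 : (1 - δ • W₃) * (1 + δ • W₃) = (1 - δ * δ) • 1 := by
          simp only [mul_add, sub_mul, smul_mul_assoc, mul_smul_comm, h₃.sq, one_mul, mul_one]
          module
        rw [← e1, ← E5, mul_smul_comm, ← mul_assoc, e2, δδ]
        simp
      have cd := (h₃.coeffs_eq h₃ E6).1
      have dc : d = δ * c := by linear_combination (-d) * δδ - δ * cd
      obtain ⟨k, hk⟩ := h₃.eq_smul_of_eigenspace h₂ hcomm δδ hδ' (η := p⁻¹ * c) (by
        rw [mul_smul, ← inv_smul_smul₀ p0 ((1 + δ • W₃) * W₂), E5, dc]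
        congr 1
        module)
      exact span (by rw [hk]; exact inSpan_left.smul k)
  · apply span
    have hpq' : p * p - q * q ≠ 0 := sub_ne_zero.2 hpq
    have E5 : (p * p - q * q) • W₂ = (p * c - q * d) • 1 + (p * d - q * c) • W₃ := by
      have e1 : (p • 1 - q • W₃) * (p • 1 + q • W₃) = (p * p - q * q) • 1 := by
        simp only [mul_add, sub_mul, smul_mul_assoc, mul_smul_comm, h₃.sq, one_mul, mul_one]
        module
      have e2 : (p • 1 - q • W₃) * (c • 1 + d • W₃)
          = (p * c - q * d) • 1 + (p * d - q * c) • W₃ := by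
        simp only [mul_add, sub_mul, smul_mul_assoc, mul_smul_comm, h₃.sq, one_mul, mul_one]
        module
      rw [← e2, ← E4', ← mul_assoc, e1, smul_mul_assoc, one_mul]
    rw [← inv_smul_smul₀ hpq' W₂, E5]
    exact ((inSpan_one.smul _).add (inSpan_left.smul _)).smul _

theorem factors_of_planar_eq_zero [Nonempty n] (h₁ : IsRefl W₁) (h₂ : IsRefl W₂) (h₃ : IsRefl W₃)
    (k₀ : IsUni u₀) (k₁ : IsUni u₁) (k₂ : IsUni u₂) (k₃ : IsUni u₃)
    (h : triple W₁ W₂ W₃ u₀ u₁ u₂ u₃ = blk A B) (hb : planar u₂ u₃ 0 0 = 0)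
    (hd : planar u₁ᴴ u₀ᴴ 0 0 = 0) (q0 : planar u₂ u₃ 0 1 ≠ 0) (d0 : planar u₁ᴴ u₀ᴴ 0 1 ≠ 0) :
    Factors A B := by
  obtain ⟨E1, -, -, E4⟩ := triple_entries h₁ h₂ h₃ k₀ k₁ k₂ k₃ h
  have P := k₂.axial_planar k₃
  have P' := k₁.conjTranspose.axial_planar k₀.conjTranspose
  rw [hb] at P
  rw [hd] at P'
  obtain ⟨ρ, hρ⟩ : ∃ ρ, axial u₂ u₃ 0 1 = ρ * planar u₂ u₃ 0 1 :=
    ⟨axial u₂ u₃ 0 1 / planar u₂ u₃ 0 1, by field_simp⟩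
  obtain ⟨ω, hω⟩ : ∃ ω, axial u₁ᴴ u₀ᴴ 0 1 = ω * planar u₁ᴴ u₀ᴴ 0 1 :=
    ⟨axial u₁ᴴ u₀ᴴ 0 1 / planar u₁ᴴ u₀ᴴ 0 1, by field_simp⟩
  -- With vanishing diagonal entries, orthogonality of the Bloch vectors makes the ratio of the
  -- off-diagonal entries purely imaginary. In particular `1 - ρ² = 1 + |ρ|²` is nonzero.
  have imag : ∀ {x q : ℂ}, q ≠ 0 → 2 * (x * q) * 0 + x * q * star q + q * star (x * q) = 0 →
      star x = -x := fun {x q} hq e => by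
    rw [star_mul'] at e
    have : (star x + x) * (q * star q) = 0 := by linear_combination e
    have := (mul_eq_zero.1 this).resolve_right (mul_ne_zero hq (star_ne_zero.2 hq))
    linear_combination this
  have ρ' : star ρ = -ρ := imag q0 (by rw [← hρ]; linear_combination P)
  have ω' : star ω = -ω := imag d0 (by rw [← hω]; linear_combination P')
  rw [hρ, hω] at E4
  have hρ1 : 1 - ρ * ρ ≠ 0 := fun h0 => by
    have h1 : (1 : ℂ) + ρ * star ρ = 0 := by rw [ρ']; linear_combination h0
    rw [Complex.star_def, Complex.mul_conj] at h1
    have h2 : (1 : ℝ) + Complex.normSq ρ = 0 := by exact_mod_cast h1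
    linarith [Complex.normSq_nonneg ρ]
  generalize planar u₂ u₃ 0 1 = q at *
  generalize planar u₁ᴴ u₀ᴴ 0 1 = d at *
  -- Inverting `W₃ + ρ` through `(W₃ - ρ)(W₃ + ρ) = 1 - ρ²` gives `W₂ = κ (W₃ - ρ)(W₁ + ω)`.
  obtain ⟨κ, hκ0, hW2⟩ : ∃ κ : ℂ, κ ≠ 0 ∧
      W₂ = κ • (W₃ * W₁ + ω • W₃ - ρ • W₁ - (ρ * ω) • 1) := by
    have e1 : (W₃ - ρ • 1) * (((ρ * q) • 1 + q • W₃) * W₂) = (q * (1 - ρ * ρ)) • W₂ := by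
      rw [← mul_assoc]
      have : (W₃ - ρ • 1) * ((ρ * q) • 1 + q • W₃) = (q * (1 - ρ * ρ)) • 1 := by
        simp only [mul_add, sub_mul, smul_mul_assoc, mul_smul_comm, h₃.sq, one_mul, mul_one]
        module
      rw [this, smul_mul_assoc, one_mul]
    have e2 : (W₃ - ρ • 1) * ((ω * d) • 1 + d • W₁)
        = d • (W₃ * W₁ + ω • W₃ - ρ • W₁ - (ρ * ω) • 1) := by
      simp only [mul_add, sub_mul, smul_mul_assoc, mul_smul_comm, one_mul, mul_one]
      module
    have hx : q * (1 - ρ * ρ) ≠ 0 := mul_ne_zero q0 hρ1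
    refine ⟨(q * (1 - ρ * ρ))⁻¹ * d, mul_ne_zero (inv_ne_zero hx) d0, ?_⟩
    rw [mul_smul, ← e2, ← E4, e1, inv_smul_smul₀ hx]
  have span : ∀ s : ℂ, W₃ * W₁ + W₁ * W₃ = s • 1 → Factors A B := fun s hs => by
    refine factors_of_triple_inSpan h₁ h₂ h₃ k₀ k₁ k₂ k₃ h h₃ h₁ hs inSpan_right ?_ inSpan_left
    rw [hW2]
    exact InSpan.smul ⟨-(ρ * ω), ω, -ρ, 1, by module⟩ κ
  have adj : κ • (W₃ * W₁ + ω • W₃ - ρ • W₁ - (ρ * ω) • 1)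
      = star κ • (W₁ * W₃ - ω • W₃ + ρ • W₁ - (ρ * ω) • 1) := by
    have e := h₂.herm
    rw [hW2] at e
    rw [← e]
    simp only [Matrix.conjTranspose_smul, Matrix.conjTranspose_add, Matrix.conjTranspose_sub,
      Matrix.conjTranspose_mul, Matrix.conjTranspose_one, h₁.herm, h₃.herm, star_mul', ρ', ω']
    module
  obtain ⟨Q, hQ, q1, q3⟩ := h₁.exists_anticomm h₃
  have c1 : Q * W₁ * Q = -W₁ := by rw [q1, neg_mul, mul_assoc, hQ.sq, mul_one]
  have c3 : Q * W₃ * Q = -W₃ := by rw [q3, neg_mul, mul_assoc, hQ.sq, mul_one]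
  have c31 : Q * (W₃ * W₁) * Q = W₃ * W₁ := by
    rw [← mul_assoc, q3, neg_mul, mul_assoc W₃, q1, mul_neg, neg_neg, mul_assoc, mul_assoc,
      hQ.sq, mul_one]
  have c13 : Q * (W₁ * W₃) * Q = W₁ * W₃ := by
    rw [← mul_assoc, q1, neg_mul, mul_assoc W₁, q3, mul_neg, neg_neg, mul_assoc, mul_assoc,
      hQ.sq, mul_one]
  -- Conjugating by `Q` flips `W₁` and `W₃`, so self-adjointness of `W₂` splits into its parts of
  -- even and odd degree.
  have adj' : κ • (W₃ * W₁ - ω • W₃ + ρ • W₁ - (ρ * ω) • 1)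
      = star κ • (W₁ * W₃ + ω • W₃ - ρ • W₁ - (ρ * ω) • 1) := by
    have e := congrArg (fun X => Q * X * Q) adj
    simp only [mul_smul_comm, smul_mul_assoc, mul_add, add_mul, mul_sub, sub_mul, c1, c3, c31,
      c13, mul_one, hQ.sq] at e
    convert e using 1 <;> module
  have even : κ • (W₃ * W₁ - (ρ * ω) • 1) = star κ • (W₁ * W₃ - (ρ * ω) • 1) := by
    have e : (1 / 2 : ℂ) • (κ • (W₃ * W₁ + ω • W₃ - ρ • W₁ - (ρ * ω) • 1)
        + κ • (W₃ * W₁ - ω • W₃ + ρ • W₁ - (ρ * ω) • 1)) = (1 / 2 : ℂ) •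
        (star κ • (W₁ * W₃ - ω • W₃ + ρ • W₁ - (ρ * ω) • 1)
        + star κ • (W₁ * W₃ + ω • W₃ - ρ • W₁ - (ρ * ω) • 1)) := by rw [adj, adj']
    convert e using 1 <;> module
  have odd : (κ + star κ) • (ω • W₃ - ρ • W₁) = 0 := by
    have e : (1 / 2 : ℂ) • (κ • (W₃ * W₁ + ω • W₃ - ρ • W₁ - (ρ * ω) • 1)
        - κ • (W₃ * W₁ - ω • W₃ + ρ • W₁ - (ρ * ω) • 1)) = (1 / 2 : ℂ) •
        (star κ • (W₁ * W₃ - ω • W₃ + ρ • W₁ - (ρ * ω) • 1)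
        - star κ • (W₁ * W₃ + ω • W₃ - ρ • W₁ - (ρ * ω) • 1)) := by rw [adj, adj']
    rw [← sub_eq_zero] at e
    rw [← e]
    module
  -- For imaginary `κ` the even part makes the anticommutator of `W₁` and `W₃` scalar. Otherwise the
  -- odd part gives `ω W₃ = ρ W₁`: either `W₃` is a multiple of `W₁`, or `ω = ρ = 0`.
  by_cases hκ : κ + star κ = 0
  · have e : star κ = -κ := by linear_combination hκ
    rw [e] at even
    apply span (2 * (ρ * ω))
    rw [← sub_eq_zero]
    have e2 : κ • (W₃ * W₁ + W₁ * W₃ - (2 * (ρ * ω)) • 1) = 0 := by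
      rw [← sub_eq_zero] at even
      rw [← even]
      module
    exact (smul_eq_zero.1 e2).resolve_left hκ0
  have hωρ := sub_eq_zero.1 ((smul_eq_zero.1 odd).resolve_left hκ)
  by_cases ω0 : ω = 0
  · rw [ω0, zero_smul] at hωρ
    have ρ0 : ρ = 0 := (smul_eq_zero.1 hωρ.symm).resolve_right h₁.ne_zero
    rw [ω0, mul_zero, zero_smul, sub_zero, sub_zero] at even
    rw [ω0, ρ0] at hW2
    simp only [zero_smul, add_zero, sub_zero, mul_zero] at hW2
    have even' : κ • (W₁ * W₃) = star κ • (W₃ * W₁) := by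
      have e := congrArg (fun X => W₁ * X * W₁) even
      simp only [mul_smul_comm, smul_mul_assoc] at e
      calc κ • (W₁ * W₃) = κ • (W₁ * (W₃ * W₁) * W₁) := by
            simp only [mul_assoc, h₁.sq, mul_one]
        _ = star κ • (W₁ * (W₁ * W₃) * W₁) := e
        _ = _ := by rw [← mul_assoc W₁, h₁.sq, one_mul]
    -- For real `κ`, `W₁` and `W₃` commute; otherwise they anticommute.
    by_cases hκκ : κ = star κ
    · rw [← hκκ] at even'
      have hcomm := smul_right_injective _ hκ0 even'
      rw [ρ0, zero_mul] at hρ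
      rw [ω0, zero_mul] at hω
      by_cases a0 : axial u₂ u₃ 0 0 = 0
      · have z₀ := k₁.conjTranspose.conjZ_eq_zero_of_axial (E1 ▸ a0) hω
        rw [k₀.conjZ_conjTranspose] at z₀
        exact factors_of_equatorial h₁ h₂ h₃ k₀ k₁ k₂ k₃ h z₀ hW2
      · have nz : ∀ {u v}, axial u v 0 0 ≠ 0 → conjZ v 0 0 ≠ 0 := fun hne h0 =>
          hne (by rw [axial, h0, zero_smul, Matrix.zero_apply])
        exact factors_of_diagOrAnti h₁ h₂ h₃ k₀ k₁ k₂ k₃ h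
          (.of_conjTranspose (k₁.conjTranspose.diagOrAnti_of_axial (nz (E1 ▸ a0)) hω))
          (k₂.diagOrAnti_of_axial (nz a0) hρ) hcomm hW2
    · apply span 0
      rw [zero_smul]
      have e2 : (κ - star κ) • (W₃ * W₁ + W₁ * W₃) = 0 := by
        have e := congrArg₂ (· + ·) even even'
        rw [← sub_eq_zero] at e
        rw [← e]
        module
      exact (smul_eq_zero.1 e2).resolve_left (sub_ne_zero.2 hκκ)
  · have e : W₃ = (ω⁻¹ * ρ) • W₁ := by rw [mul_smul, ← hωρ, inv_smul_smul₀ ω0]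
    apply span (2 * (ω⁻¹ * ρ))
    rw [e, mul_smul_comm, smul_mul_assoc, h₁.sq]
    module

/-- A block-diagonal product with three controlled reflections either uses only diagonal and
anti-diagonal one-qubit gates, or its blocks differ by a product of two balanced unitaries. -/
theorem diagOrAnti_or_factors [Nonempty n] (h₁ : IsRefl W₁) (h₂ : IsRefl W₂) (h₃ : IsRefl W₃)
    (k₀ : IsUni u₀) (k₁ : IsUni u₁) (k₂ : IsUni u₂) (k₃ : IsUni u₃)
    (h : triple W₁ W₂ W₃ u₀ u₁ u₂ u₃ = blk A B) :
    (DiagOrAnti u₀ ∧ DiagOrAnti u₁ ∧ DiagOrAnti u₂ ∧ DiagOrAnti u₃) ∨ Factors A B := by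
  obtain ⟨E1, E2, E3, E4⟩ := triple_entries h₁ h₂ h₃ k₀ k₁ k₂ k₃ h
  by_cases hb : planar u₂ u₃ 0 0 = 0
  swap
  · exact Or.inr (factors_of_planar_ne_zero h₁ h₂ h₃ k₀ k₁ k₂ k₃ h hb)
  have hd : planar u₁ᴴ u₀ᴴ 0 0 = 0 := by
    rw [hb, zero_smul] at E2
    exact (smul_eq_zero.1 E2.symm).resolve_right h₁.ne_zero
  by_cases q0 : planar u₂ u₃ 0 1 = 0
  -- With no planar part, `u₃` is diagonal or anti-diagonal, and `E4` makes `W₂` a multiple of `W₁`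
  -- unless its coefficient vanishes. That vanishing is the only branch where all four gates are
  -- forced to be diagonal or anti-diagonal.
  · obtain ⟨d₃, z₃⟩ := k₂.diagOrAnti_of_planar k₃ hb q0
    have E5 : (0 : ℂ) • 1 + axial u₂ u₃ 0 1 • W₂
        = axial u₁ᴴ u₀ᴴ 0 1 • 1 + planar u₁ᴴ u₀ᴴ 0 1 • W₁ := by
      rw [← E4, q0]; simp
    obtain ⟨c0, hpd⟩ := h₂.coeffs_eq h₁ E5
    by_cases p0 : axial u₂ u₃ 0 1 = 0
    · left
      rw [p0, zero_smul] at hpd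
      have d0 := (smul_eq_zero.1 hpd.symm).resolve_right h₁.ne_zero
      obtain ⟨d₀, z₀⟩ := k₁.conjTranspose.diagOrAnti_of_planar k₀.conjTranspose hd d0
      exact ⟨.of_conjTranspose d₀,
        .of_conjTranspose (k₁.conjTranspose.diagOrAnti_of_axial z₀ c0.symm),
        k₂.diagOrAnti_of_axial z₃ p0, d₃⟩
    · right
      refine factors_of_smul_left h₁ h₂ h₃ k₀ k₁ k₂ k₃ h d₃
        (k := (axial u₂ u₃ 0 1)⁻¹ * planar u₁ᴴ u₀ᴴ 0 1) ?_
      rw [mul_smul, ← hpd, inv_smul_smul₀ p0]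
  by_cases d0 : planar u₁ᴴ u₀ᴴ 0 1 = 0
  · right
    obtain ⟨d₀, -⟩ := k₁.conjTranspose.diagOrAnti_of_planar k₀.conjTranspose hd d0
    have E5 : axial u₂ u₃ 0 1 • 1 + planar u₂ u₃ 0 1 • W₃
        = (0 : ℂ) • 1 + axial u₁ᴴ u₀ᴴ 0 1 • W₂ := by
      rw [d0, zero_smul, add_zero] at E4
      calc _ = (axial u₂ u₃ 0 1 • 1 + planar u₂ u₃ 0 1 • W₃) * W₂ * W₂ := by
            rw [mul_assoc, h₂.sq, mul_one]
        _ = _ := by rw [E4, smul_mul_assoc, one_mul, zero_smul, zero_add]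
    obtain ⟨-, e⟩ := h₃.coeffs_eq h₂ E5
    have c0 : axial u₁ᴴ u₀ᴴ 0 1 ≠ 0 := fun c0 => by
      rw [c0, zero_smul, smul_eq_zero] at e
      exact e.elim q0 h₃.ne_zero
    refine factors_of_smul_right h₁ h₂ h₃ k₀ k₁ k₂ k₃ h (.of_conjTranspose d₀)
      (k := (axial u₁ᴴ u₀ᴴ 0 1)⁻¹ * planar u₂ u₃ 0 1) ?_
    rw [mul_smul, e, inv_smul_smul₀ c0]
  · exact Or.inr (factors_of_planar_eq_zero h₁ h₂ h₃ k₀ k₁ k₂ k₃ h hb hd q0 d0)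

end Core

/-! ### Translation between circuits and block operators. -/

section Circuits

variable {N : ℕ} {l : Fin N}

/-- An `N`-qubit operator as a block operator, the blocks being indexed by the qubit `l`. -/
def toBlocks (l : Fin N) : Matrix (Basis (Fin N)) (Basis (Fin N)) ℂ ≃+*
    Matrix (Fin 2) (Fin 2) (Matrix (Basis {k // k ≠ l}) (Basis {k // k ≠ l}) ℂ) :=
  (Matrix.reindexAlgEquiv ℂ ℂ (Equiv.funSplitAt l (Fin 2))).toRingEquiv.trans
    (Matrix.compRingEquiv (Fin 2) (Basis {k // k ≠ l}) ℂ).symm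

theorem toBlocks_apply (M : Matrix (Basis (Fin N)) (Basis (Fin N)) ℂ) (i j : Fin 2)
    (x y : Basis {k // k ≠ l}) : toBlocks l M i j x y
      = M ((Equiv.funSplitAt l (Fin 2)).symm (i, x)) ((Equiv.funSplitAt l (Fin 2)).symm (j, y)) :=
  rfl

theorem funSplitAt_symm_self (i : Fin 2) (x : Basis {k // k ≠ l}) :
    (Equiv.funSplitAt l (Fin 2)).symm (i, x) l = i := by
  simp

theorem funSplitAt_symm_of_ne (i : Fin 2) (x : Basis {k // k ≠ l}) (k : {k // k ≠ l}) :
    (Equiv.funSplitAt l (Fin 2)).symm (i, x) k = x k := by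
  simp [k.2]

theorem toBlocks_onQubit (u : Matrix (Fin 2) (Fin 2) ℂ) : toBlocks l (onQubit l u) = scal u := by
  refine Matrix.ext fun i j => Matrix.ext fun x y => ?_
  rw [toBlocks_apply, scal_apply, onQubit, Matrix.of_apply, funSplitAt_symm_self,
    funSplitAt_symm_self, Matrix.smul_apply, Matrix.one_apply]
  have : (∀ k, k ≠ l → (Equiv.funSplitAt l (Fin 2)).symm (i, x) k
      = (Equiv.funSplitAt l (Fin 2)).symm (j, y) k) ↔ x = y := by
    constructor
    · intro h
      funext k
      have := h k k.2
      rwa [funSplitAt_symm_of_ne, funSplitAt_symm_of_ne] at this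
    · rintro rfl k hk
      rw [funSplitAt_symm_of_ne i x ⟨k, hk⟩, funSplitAt_symm_of_ne j x ⟨k, hk⟩]
  simp only [this]
  split_ifs <;> simp

theorem toBlocks_awayFrom (V : Matrix (Basis {k // k ≠ l}) (Basis {k // k ≠ l}) ℂ) :
    toBlocks l (awayFrom l V) = blk V V := by
  refine Matrix.ext fun i j => Matrix.ext fun x y => ?_
  rw [toBlocks_apply, awayFrom, Matrix.of_apply, funSplitAt_symm_self, funSplitAt_symm_self]
  simp only [funSplitAt_symm_of_ne]
  fin_cases i <;> fin_cases j <;> simp [blk]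

/-- The operator `Z` on the qubit `m` of a register. -/
def zOp {κ : Type} [Fintype κ] [DecidableEq κ] (m : κ) : Matrix (Basis κ) (Basis κ) ℂ :=
  Matrix.diagonal fun x => if x m = 1 then -1 else 1

theorem isRefl_zOp {κ : Type} [Fintype κ] [DecidableEq κ] (m : κ) : IsRefl (zOp m) := by
  refine ⟨?_, ?_, ?_⟩
  · rw [zOp, Matrix.diagonal_conjTranspose]
    congr 1
    funext x
    simp only [Pi.star_apply]
    split_ifs <;> simp
  · rw [zOp, Matrix.diagonal_mul_diagonal, ← Matrix.diagonal_one]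
    congr 1
    funext x
    split_ifs <;> simp
  · rw [zOp, Matrix.trace_diagonal]
    have two : ∀ a : Fin 2, a + 1 + 1 = a := by decide
    have flip : ∀ a : Fin 2, (if a = 1 then (-1 : ℂ) else 1) + (if a + 1 = 1 then -1 else 1) = 0 := by
      intro a
      fin_cases a <;> simp
    -- Flipping the bit `m` pairs opposite signs.
    refine Finset.sum_involution (fun x _ => Function.update x m (x m + 1)) ?_ ?_ ?_ ?_
    · intro x _
      simpa using flip (x m)
    · intro x _ _ h
      have := congrFun h m
      rw [Function.update_self] at this
      revert this
      generalize x m = a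
      revert a
      decide
    · simp
    · intro x _
      simp [two]

theorem toBlocks_czOp (m : {k : Fin N // k ≠ l}) : toBlocks l (czOp l m) = blk 1 (zOp m) := by
  refine Matrix.ext fun i j => Matrix.ext fun x y => ?_
  rw [toBlocks_apply, czOp, Matrix.diagonal_apply]
  simp only [EmbeddingLike.apply_eq_iff_eq, funSplitAt_symm_self, funSplitAt_symm_of_ne]
  fin_cases i <;> fin_cases j <;> simp [blk, zOp, Matrix.diagonal_apply, Matrix.one_apply]

/-- The alternating product of one-qubit gates and controlled gates. -/
def alternating {n : Type*} [Fintype n] [DecidableEq n] :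
    List (Matrix.unitaryGroup (Fin 2) ℂ) → List (Matrix n n ℂ) →
      Matrix (Fin 2) (Fin 2) (Matrix n n ℂ)
  | g :: gs, W :: Ws => scal g * (blk 1 W * alternating gs Ws)
  | g :: _, [] => scal g
  | [], _ => 1

theorem blk_self_alternating {n : Type*} [Fintype n] [DecidableEq n] {V : Matrix n n ℂ}
    (hV : Vᴴ * V = 1) (gs : List (Matrix.unitaryGroup (Fin 2) ℂ)) (Ws : List (Matrix n n ℂ)) :
    blk V V * alternating gs Ws = alternating gs (Ws.map fun W => V * W * Vᴴ) * blk V V := by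
  induction gs generalizing Ws with
  | nil => simp [alternating]
  | cons g gs ih =>
    cases Ws with
    | nil => simp [alternating, blk_self_scal]
    | cons W Ws =>
      have hW : blk V V * blk 1 W = blk 1 (V * W * Vᴴ) * blk V V := by
        rw [blk_mul_blk, blk_mul_blk, mul_assoc (V * W), hV]
        simp
      simp only [alternating, List.map_cons]
      rw [← mul_assoc, blk_self_scal, mul_assoc, ← mul_assoc (blk V V), hW, mul_assoc, ih]
      simp only [mul_assoc]

theorem Circuit.mergedGates_ne_nil (C : Circuit l) : C.mergedGates ≠ [] := by
  induction C with
  | nil => simp [Circuit.mergedGates]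
  | cons g C ih => cases g <;> simp [Circuit.mergedGates, ih]

theorem Circuit.length_mergedGates (C : Circuit l) : C.mergedGates.length = C.czCount + 1 := by
  induction C with
  | nil => rfl
  | cons g C ih => cases g <;> simp [Circuit.mergedGates, Circuit.czCount, ih]

theorem IsRefl.conj {n : Type*} [Fintype n] [DecidableEq n] {W V : Matrix n n ℂ} (h : IsRefl W)
    (h1 : Vᴴ * V = 1) (h2 : V * Vᴴ = 1) : IsRefl (V * W * Vᴴ) := by
  refine ⟨?_, by rw [conj_mul_conj h1, h.sq, mul_one, h2], by rw [trace_conj h1, h.tr]⟩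
  simp only [Matrix.conjTranspose_mul, Matrix.conjTranspose_conjTranspose, h.herm, mul_assoc]

theorem unitaryGroup_mul {n : Type*} [Fintype n] [DecidableEq n] (V : Matrix.unitaryGroup n ℂ) :
    (V : Matrix n n ℂ)ᴴ * V = 1 ∧ (V : Matrix n n ℂ) * (V : Matrix n n ℂ)ᴴ = 1 :=
  ⟨Matrix.mem_unitaryGroup_iff'.1 V.2, Matrix.mem_unitaryGroup_iff.1 V.2⟩

/-- Gates away from `l` are pushed to the right end, where they accumulate in `V`, and conjugate the
reflections they pass. The merged gates on `l` are untouched. -/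
theorem Circuit.toBlocks_op (C : Circuit l) :
    ∃ (Ws : List (Matrix (Basis {k // k ≠ l}) (Basis {k // k ≠ l}) ℂ))
      (V : Matrix (Basis {k // k ≠ l}) (Basis {k // k ≠ l}) ℂ),
      Ws.length = C.czCount ∧ (∀ W ∈ Ws, IsRefl W) ∧ (Vᴴ * V = 1 ∧ V * Vᴴ = 1) ∧
      toBlocks l C.op = alternating C.mergedGates Ws * blk V V := by
  induction C with
  | nil =>
    refine ⟨[], 1, rfl, by simp, by simp, ?_⟩
    simp [Circuit.op, Circuit.mergedGates, alternating, blk_one]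
  | cons g C ih =>
    obtain ⟨Ws, V, hl, hW, hV, e⟩ := ih
    have hop : toBlocks l (Circuit.op (g :: C)) = toBlocks l g.op * toBlocks l (Circuit.op C) := by
      simp [Circuit.op]
    rw [hop, e]
    cases g with
    | oneQubit u =>
      refine ⟨Ws, V, hl, hW, hV, ?_⟩
      obtain ⟨g, gs, hg⟩ := List.exists_cons_of_ne_nil (Circuit.mergedGates_ne_nil C)
      have hm : Circuit.mergedGates (.oneQubit u :: C) = (u * g) :: gs := by
        simp [Circuit.mergedGates, hg]
      rw [hm, hg, Gate.op, toBlocks_onQubit]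
      cases Ws <;> simp [alternating, mul_assoc]
    | cz m =>
      refine ⟨zOp m :: Ws, V, by simp [Circuit.czCount, hl], ?_, hV, ?_⟩
      · simpa using ⟨isRefl_zOp m, hW⟩
      · simp [Circuit.mergedGates, alternating, Gate.op, toBlocks_czOp, mul_assoc]
    | away V' =>
      have hV' := unitaryGroup_mul V'
      refine ⟨Ws.map fun W => (V' : Matrix _ _ ℂ) * W * (V' : Matrix _ _ ℂ)ᴴ, V' * V, by simpa [Circuit.czCount], ?_,
        ⟨unitary_mul hV'.1 hV.1, mul_unitary hV'.2 hV.2⟩, ?_⟩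
      · intro W h
        obtain ⟨W', h', rfl⟩ := List.mem_map.1 h
        exact (hW W' h').conj hV'.1 hV'.2
      · rw [Gate.op, toBlocks_awayFrom, ← mul_assoc, blk_self_alternating hV'.1, mul_assoc,
          blk_mul_blk]
        rfl

theorem Circuit.exists_ne_of_czCount (C : Circuit l) (h : C.czCount ≠ 0) :
    Nonempty {k : Fin N // k ≠ l} := by
  induction C with
  | nil => exact absurd rfl h
  | cons g C ih =>
    cases g with
    | cz m => exact ⟨m⟩
    | oneQubit u => exact ih h
    | away V => exact ih h

theorem IsBal.exists_smul {n : Type*} [Fintype n] [DecidableEq n] [Nonempty n] {F Z : Matrix n n ℂ}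
    (h : IsBal F) (hZ : IsRefl Z) :
    ∃ (f : ℂ) (U : Matrix n n ℂ), f * star f = 1 ∧ Uᴴ * U = 1 ∧ U * Uᴴ = 1 ∧
      F = f • (U * Z * Uᴴ) := by
  obtain ⟨c, hc⟩ := h.sq
  rcases exists_smul_refl (x := 0) h.left (by simp) hc h.tr with h0 | ⟨f, W, hW, e⟩
  · have := h.left
    rw [h0, mul_zero] at this
    exact absurd this zero_ne_one
  · obtain ⟨U, h1, h2, rfl⟩ := hW.exists_conj hZ
    refine ⟨f, U, ?_, h1, h2, e⟩
    have h3 := h.right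
    rw [e, Matrix.conjTranspose_smul, smul_mul_smul_comm, hW.herm, hW.sq] at h3
    obtain ⟨i⟩ := ‹Nonempty n›
    simpa using congrFun (congrFun h3 i) i

/-- With `F = f U Z Uᴴ`, a `CZ` conjugated by `U` gives the controlled reflection, and `diag(1, f)`
on `l` supplies the phase. -/
theorem exists_circuit_ctl (m : {k : Fin N // k ≠ l})
    {F : Matrix (Basis {k // k ≠ l}) (Basis {k // k ≠ l}) ℂ} (h : IsBal F) :
    ∃ C : Circuit l, C.czCount = 1 ∧ toBlocks l C.op = blk 1 F := by
  obtain ⟨f, U, hf, h1, h2, e⟩ := h.exists_smul (isRefl_zOp m)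
  have hD : !![1, 0; 0, f] ∈ Matrix.unitaryGroup (Fin 2) ℂ := by
    rw [Matrix.mem_unitaryGroup_iff]
    ext i j
    fin_cases i <;> fin_cases j <;>
      simp [Matrix.mul_apply, Fin.sum_univ_two, Matrix.star_apply]
    exact hf
  refine ⟨[.oneQubit ⟨_, hD⟩, .away ⟨U, Matrix.mem_unitaryGroup_iff.2 h2⟩, .cz m,
    .away ⟨Uᴴ, Matrix.mem_unitaryGroup_iff.2 (by simpa [Matrix.star_eq_conjTranspose] using h1)⟩],
    rfl, ?_⟩
  simp only [Circuit.op, List.map_cons, List.map_nil, List.prod_cons, List.prod_nil, map_mul,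
    Gate.op, toBlocks_onQubit, toBlocks_awayFrom, toBlocks_czOp, mul_one, blk_mul_blk,
    one_mul, h2]
  refine Matrix.ext fun i j => ?_
  rw [mul_blk_apply, scal_apply]
  fin_cases i <;> fin_cases j <;> simp [blk, e, mul_assoc]

theorem Circuit.czCount_append (C D : Circuit l) :
    Circuit.czCount (C ++ D) = C.czCount + D.czCount := by
  induction C with
  | nil => simp [Circuit.czCount]
  | cons g C ih =>
    rw [List.cons_append]
    cases g <;> simp only [Circuit.czCount, ih] <;> omega

theorem Circuit.op_append (C D : Circuit l) : Circuit.op (C ++ D) = C.op * D.op := by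
  simp [Circuit.op]

theorem Factors.exists_circuit (m : {k : Fin N // k ≠ l})
    {A B V : Matrix (Basis {k // k ≠ l}) (Basis {k // k ≠ l}) ℂ} (h : Factors A B)
    (hA : A * Aᴴ = 1) (hV : V * Vᴴ = 1) :
    ∃ C : Circuit l, C.czCount = 2 ∧ toBlocks l C.op = blk A B * blk V V := by
  obtain ⟨F, G, hF, hG, e⟩ := h
  obtain ⟨C, c1, c2⟩ := exists_circuit_ctl m hF
  obtain ⟨D, d1, d2⟩ := exists_circuit_ctl m hG
  refine ⟨[.away ⟨A, Matrix.mem_unitaryGroup_iff.2 hA⟩] ++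
    (C ++ (D ++ [.away ⟨V, Matrix.mem_unitaryGroup_iff.2 hV⟩])), ?_, ?_⟩
  · simp [Circuit.czCount_append, c1, d1, Circuit.czCount]
  · have single : ∀ g : Gate l, toBlocks l (Circuit.op [g]) = toBlocks l g.op := fun g => by
      simp [Circuit.op]
    rw [Circuit.op_append, Circuit.op_append, Circuit.op_append, map_mul, map_mul, map_mul, c2, d2,
      single, single, Gate.op, Gate.op, toBlocks_awayFrom, toBlocks_awayFrom, blk_mul_blk,
      blk_mul_blk, blk_mul_blk, blk_mul_blk, e]
    simp [mul_assoc]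

theorem eq_blk_of_commute {n : Type*} [Fintype n] [DecidableEq n]
    {X : Matrix (Fin 2) (Fin 2) (Matrix n n ℂ)} (h : Commute X (scal pauliZ)) :
    X = blk (X 0 0) (X 1 1) := by
  have e : (scal pauliZ : Matrix (Fin 2) (Fin 2) (Matrix n n ℂ)) = blk 1 (-1) := by
    rw [blk_one_neg, blk_one, mul_one]
  rw [e] at h
  have h1 : ∀ i j, X i j * ![1, -1] j = ![1, -1] i * X i j := fun i j => by
    rw [← blk_mul_apply, ← mul_blk_apply, h.eq]
  have zero : ∀ {Y : Matrix n n ℂ}, Y = -Y → Y = 0 := fun {Y} h => by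
    have h2 : (2 : ℂ) • Y = 0 := by rw [two_smul]; nth_rw 1 [h]; exact neg_add_cancel Y
    exact (smul_eq_zero.1 h2).resolve_left two_ne_zero
  have h01 : X 0 1 = 0 := zero (by simpa using (h1 0 1).symm)
  have h10 : X 1 0 = 0 := zero (by simpa using h1 1 0)
  refine Matrix.ext fun i j => ?_
  fin_cases i <;> fin_cases j <;> simp [blk, h01, h10]

theorem isUni_coe (u : Matrix.unitaryGroup (Fin 2) ℂ) : IsUni (u : Matrix (Fin 2) (Fin 2) ℂ) :=
  ⟨(unitaryGroup_mul u).1, (unitaryGroup_mul u).2⟩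

theorem DiagOrAnti.isDiag_or {u : Matrix (Fin 2) (Fin 2) ℂ} (h : DiagOrAnti u) :
    u.IsDiag ∨ IsAntiDiag u := by
  refine h.imp (fun h i j hij => ?_) (fun h i j hij => ?_) <;> obtain ⟨h1, h2⟩ := h <;>
    fin_cases i <;> fin_cases j <;>
    simp [pauliX, Matrix.mul_apply, Fin.sum_univ_two, h1, h2] at hij ⊢

end Circuits

end LocalCZ

theorem mainTheorem9 (N : ℕ) (l : Fin N)
    (M : Matrix (LocalCZ.Basis (Fin N)) (LocalCZ.Basis (Fin N)) ℂ)
    (hM : M ∈ Matrix.unitaryGroup (LocalCZ.Basis (Fin N)) ℂ)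
    (hZ : Commute M (LocalCZ.onQubit l LocalCZ.pauliZ))
    (hcost : LocalCZ.czCost l M = 3)
    (C : LocalCZ.Circuit l) (hC : C.op = M) (hcount : C.czCount = 3) :
    ∀ u ∈ C.mergedGates,
      (u : Matrix (Fin 2) (Fin 2) ℂ).IsDiag ∨
        LocalCZ.IsAntiDiag (u : Matrix (Fin 2) (Fin 2) ℂ) := by
  open LocalCZ in
  -- The cheaper circuit will need some qubit other than `l` as partner of its `CZ` gates.
  obtain ⟨m⟩ := C.exists_ne_of_czCount (by rw [hcount]; norm_num)
  obtain ⟨Ws, V, hl, hW, hV, e⟩ := C.toBlocks_op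
  have hg := C.length_mergedGates
  rw [hcount] at hl hg
  obtain ⟨W₁, W₂, W₃, rfl⟩ := List.length_eq_three.1 hl
  obtain ⟨u₀, u₁, u₂, u₃, hu⟩ : ∃ u₀ u₁ u₂ u₃, C.mergedGates = [u₀, u₁, u₂, u₃] := by
    match hm : C.mergedGates, hg with
    | [u₀, u₁, u₂, u₃], _ => exact ⟨u₀, u₁, u₂, u₃, rfl⟩
  have h₁ : IsRefl W₁ := hW _ (by simp)
  have h₂ : IsRefl W₂ := hW _ (by simp)
  have h₃ : IsRefl W₃ := hW _ (by simp)
  have e' : toBlocks l M = triple W₁ W₂ W₃ u₀ u₁ u₂ u₃ * blk V V := by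
    rw [← hC, e, hu]
    rfl
  have hT : triple W₁ W₂ W₃ (u₀ : Matrix (Fin 2) (Fin 2) ℂ) u₁ u₂ u₃ = toBlocks l M * blk Vᴴ Vᴴ := by
    rw [e', mul_assoc, blk_mul_blk, hV.2, blk_one, mul_one]
  have hc : Commute (toBlocks l M) (scal pauliZ) := by
    rw [← toBlocks_onQubit]
    exact hZ.map (toBlocks l)
  have hb := eq_blk_of_commute (hT ▸ hc.mul_left (blk_scal_pauliZ Vᴴ Vᴴ))
  have k₀ := isUni_coe u₀
  have k₁ := isUni_coe u₁
  have k₂ := isUni_coe u₂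
  have k₃ := isUni_coe u₃
  rcases diagOrAnti_or_factors h₁ h₂ h₃ k₀ k₁ k₂ k₃ hb with ⟨d₀, d₁, d₂, d₃⟩ | hF
  · intro u h
    rw [hu] at h
    simp only [List.mem_cons, List.not_mem_nil, or_false] at h
    rcases h with rfl | rfl | rfl | rfl
    exacts [d₀.isDiag_or, d₁.isDiag_or, d₂.isDiag_or, d₃.isDiag_or]
  -- The factorization gives a circuit for `M` with two `CZ` gates at `l`, below the assumed
  -- minimum.
  · exfalso
    obtain ⟨D, hD, hDe⟩ := hF.exists_circuit m
      (unitary_of_triple h₁ h₂ h₃ k₀ k₁ k₂ k₃ hb).1.2 hV.2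
    rw [← hb, ← e'] at hDe
    have hle : czCost l M ≤ (D.czCount : ℕ∞) :=
      iInf_le (fun C : {C : Circuit l // C.op = M} => (C.1.czCount : ℕ∞))
        ⟨D, (toBlocks l).injective hDe⟩
    rw [hcost, hD] at hle
    exact absurd hle (by decide)
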